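/- Let $N\ge 1$, $0<s<1<p$ with $sp<N$. For measurable $u:\mathbb R^N\to\mathbb R$ put $$\|u\|_{s,p}^p=\int_{\mathbb R^N\times\mathbb R^N}\frac{|u(x)-u(y)|^p}{|x-y|^{N+sp}}\,dx\,dy,$$ and let $\mathcal D^{s,p}(\mathbb R^N)$ be the completion of $C_c^1(\mathbb R^N)$ with respect to $\|\cdot\|_{s,p}$, regarded as a space of functions (limits, in $\|\cdot\|_{s,p}$ and almost everywhere, of sequences in $C_c^1(\mathbb R^N)$). For a measurable relatively compact set $F\subset\mathbb R^N$ let $\mathrm{Cap}_{s,p}(F)=\inf\{\|u\|_{s,p}^p: u\in\mathcal D^{s,p}(\mathbb R^N),\ u\ge 1\text{ a.e. in }F\}$. Let $\mathcal H_{s,p}(\mathbb R^N)$ be the set of $w\in L^1_{loc}(\mathbb R^N)$ for which there is $C>0$ with $\int_{\mathbb R^N}|w||u|^p\,dx\le C\|u\|_{s,p}^p$ for all $u\in\mathcal D^{s,p}(\mathbb R^N)$, with the norm $\|w\|=\sup_F \big(\int_F|w|\,dx\big)/\mathrm{Cap}_{s,p}(F)$ (supremum over measurable relatively compact $F$, with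 $0/0=0$), and let $\mathcal H_{s,p,0}(\mathbb R^N)$ be the closure of $C_c(\mathbb R^N)$ in it. Let $w=w_1-w_2$ with $w_1,w_2\ge 0$ a.e., $w_1\in\mathcal H_{s,p,0}(\mathbb R^N)$ and $w_2\in L^1_{loc}(\mathbb R^N)$. A real number $\lambda$ is an eigenvalue of $(-\Delta_p)^su=\lambda w|u|^{p-2}u$ in $\mathbb R^N$, with eigenfunction $u$, if $u\in\mathcal D^{s,p}(\mathbb R^N)$, $u\not\equiv 0$, and for every $v\in\mathcal D^{s,p}(\mathbb R^N)$ the function $w|u|^{p-2}uv$ is integrable and $$\int_{\mathbb R^N\times\mathbb R^N}\frac{|u(x)-u(y)|^{p-2}(u(x)-u(y))(v(x)-v(y))}{|x-y|^{N+sp}}\,dx\,dy=\lambda\int_{\mathbb R^N}w|u|^{p-2}uv\,dx .$$ Let $$\lambda_1=\inf\Big\{\|u\|_{s,p}^p: u\in\mathcal D^{s,p}(\mathbb R^N),\ w|u|^p\in L^1(\mathbb R^N),\ \int_{\mathbb R^N}w|u|^p\,dx=1\Big\}.$$ Then every eigenfunction $u$ belonging to an eigenvalue $\lambda\ge 0$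 with $\lambda\ne\lambda_1$ changes sign, that is, both $\{u>0\}$ and $\{u<0\}$ have positive Lebesgue measure. (If no admissible $u$ exists in the definition of $\lambda_1$, the conclusion holds for every eigenvalue $\lambda\ge 0$ under either convention $\lambda_1=0$ or $\lambda_1=+\infty$, because there are then no such eigenvalues.) -/

import Mathlib

open MeasureTheory Filter Topology
open scoped ENNReal NNReal

namespace FracHardy

/-- The space `ℝ^N` with its Euclidean norm and Lebesgue measure. -/
abbrev RN (N : ℕ) : Type := EuclideanSpace ℝ (Fin N)

/-- The `p`-th power `‖u‖_{s,p}^p` of the Gagliardo seminorm, as an extended nonnegative number: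
the integral of `|u x - u y| ^ p / |x - y| ^ (N + s p)` over `ℝ^N × ℝ^N`. -/
noncomputable def energy {N : ℕ} (s p : ℝ) (u : RN N → ℝ) : ℝ≥0∞ :=
  ∫⁻ z : RN N × RN N,
    ENNReal.ofReal (|u z.1 - u z.2| ^ p / ‖z.1 - z.2‖ ^ ((N : ℝ) + s * p))

/-- Membership in `𝓓^{s,p}(ℝ^N)`, the completion of `C_c^1(ℝ^N)` for `‖·‖_{s,p}`, realized as a
space of (a.e. classes of) functions: `u` is the limit, both in `‖·‖_{s,p}` and almost everywhere,
of a sequence in `C_c^1(ℝ^N)`. (The seminorm alone does not see additive constants; the a.e.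
convergence fixes the representative of the limit.) -/
def MemD {N : ℕ} (s p : ℝ) (u : RN N → ℝ) : Prop :=
  ∃ φ : ℕ → RN N → ℝ,
    (∀ n, ContDiff ℝ 1 (φ n) ∧ HasCompactSupport (φ n)) ∧
    Tendsto (fun n => energy s p (fun x => φ n x - u x)) atTop (𝓝 0) ∧
    ∀ᵐ x, Tendsto (fun n => φ n x) atTop (𝓝 (u x))

/-- The `(s,p)`-capacity of a set `F` relative to `ℝ^N`. -/
noncomputable def cap {N : ℕ} (s p : ℝ) (F : Set (RN N)) : ℝ≥0∞ :=
  ⨅ u ∈ {u : RN N → ℝ | MemD s p u ∧ ∀ᵐ x ∂(volume.restrict F), 1 ≤ u x}, energy s p u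

/-- The norm of the space of `(s,p)`-Hardy potentials: the supremum of `(∫_F |w|) / Cap_{s,p}(F)`
over measurable relatively compact sets `F` (with `0 / 0 = 0`, as for null sets `F`). -/
noncomputable def hardyNorm {N : ℕ} (s p : ℝ) (w : RN N → ℝ) : ℝ≥0∞ :=
  ⨆ F ∈ {F : Set (RN N) | MeasurableSet F ∧ IsCompact (closure F)},
    (∫⁻ x in F, ENNReal.ofReal |w x|) / cap s p F

/-- `(s,p)`-Hardy potentials: locally integrable weights satisfying the fractional Hardy
inequality with some constant. -/
def MemHardy {N : ℕ} (s p : ℝ) (w : RN N → ℝ) : Prop :=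
  LocallyIntegrable w ∧
    ∃ C : ℝ≥0, ∀ u : RN N → ℝ, MemD s p u →
      ∫⁻ x, ENNReal.ofReal (|w x| * |u x| ^ p) ≤ (C : ℝ≥0∞) * energy s p u

/-- The closure of `C_c(ℝ^N)` in the space of `(s,p)`-Hardy potentials. -/
def MemHardyZero {N : ℕ} (s p : ℝ) (w : RN N → ℝ) : Prop :=
  MemHardy s p w ∧
    ∀ ε : ℝ≥0∞, 0 < ε → ∃ g : RN N → ℝ, Continuous g ∧ HasCompactSupport g ∧
      hardyNorm s p (fun x => w x - g x) < ε

/-- The weak form of the fractional `p`-Laplacian, tested with `v`. -/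
noncomputable def weakForm {N : ℕ} (s p : ℝ) (u v : RN N → ℝ) : ℝ :=
  ∫ z : RN N × RN N,
    |u z.1 - u z.2| ^ (p - 2) * (u z.1 - u z.2) * (v z.1 - v z.2) /
      ‖z.1 - z.2‖ ^ ((N : ℝ) + s * p)

/-- `u` is an eigenfunction, belonging to the eigenvalue `lam`, of
`(-Δ_p)^s u = lam * w * |u|^(p-2) * u` in `ℝ^N`: a nonzero element of `𝓓^{s,p}(ℝ^N)` satisfying the
weak equation (whose right-hand side is in particular meaningful) for every test function in
`𝓓^{s,p}(ℝ^N)`. -/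
def IsEigenfunction {N : ℕ} (s p : ℝ) (w : RN N → ℝ) (lam : ℝ) (u : RN N → ℝ) : Prop :=
  MemD s p u ∧ ¬ (∀ᵐ x, u x = 0) ∧
    ∀ v : RN N → ℝ, MemD s p v →
      Integrable (fun x => w x * |u x| ^ (p - 2) * u x * v x) ∧
      weakForm s p u v = lam * ∫ x, w x * |u x| ^ (p - 2) * u x * v x

/-- The first eigenvalue: the infimum of `‖u‖_{s,p}^p` over all `u ∈ 𝓓^{s,p}(ℝ^N)` such that
`w |u|^p` is integrable with integral `1`. -/
noncomputable def firstEigenvalue {N : ℕ} (s p : ℝ) (w : RN N → ℝ) : ℝ :=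
  sInf {t : ℝ | ∃ u : RN N → ℝ, MemD s p u ∧ Integrable (fun x => w x * |u x| ^ p) ∧
    ∫ x, w x * |u x| ^ p = 1 ∧ t = (energy s p u).toReal}

/-- `u` changes sign: it is positive on a set of positive measure and negative on a set of
positive measure. -/
def ChangesSign {N : ℕ} (u : RN N → ℝ) : Prop :=
  0 < volume {x | 0 < u x} ∧ 0 < volume {x | u x < 0}

end FracHardy

namespace FracHardy

/-! ### Elementary facts on the Gagliardo energy -/

/-! The contrapositive is proved: an eigenfunction of constant sign with `0 ≤ lam` has `lam` equal
to the first eigenvalue. Replacing `u` by `-u` if necessary, let `u ≥ 0` a.e.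

Positivity (`IsEigenfunction.ae_pos`). Test functions decreasing to `φ · 1_{u = 0}` annihilate the
right-hand side in the limit, while the limiting integrand on the left is nonpositive, and strictly
negative where `u x = 0 < u y` and `φ x > 0`. Hence `{u = 0} × {u > 0}` is null. The operator is
nonlocal, so this alone gives `u > 0` a.e., without a Harnack inequality.

Lower bound (`IsEigenfunction.mul_integral_le_energy`). Testing with regularizations of `|v|^p /
u^(p-1)` and using the discrete Picone inequality gives `lam ∫ w|v|^p ≤ ‖v‖^p` for each `v` with
`w|v|^p` integrable, so `lam` is at most every competitor in the infimum. Testing with `u` itself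
gives `lam ∫ w|u|^p = ‖u‖^p`. This is positive, so a multiple of `u` is admissible and attains the
value `lam`.

Two facts about the function space support this. `MemD.comp₂` says that Lipschitz functions of two
elements vanishing at the origin stay in the space, which makes all the test functions legitimate.
`MemD.ae_eq_zero_of_energy_eq_zero` says that the seminorm is definite there, which is where `s * p
< N` enters. Integrability of the right-hand side comes from the definition of an eigenfunction and
drives the dominated convergence arguments. -/

lemma abs_add_rpow_le {p : ℝ} (hp : 0 ≤ p) (a b : ℝ) :
    |a + b| ^ p ≤ 2 ^ p * (|a| ^ p + |b| ^ p) := by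
  have h1 : |a + b| ≤ 2 * max |a| |b| := by
    have := abs_add_le a b
    have := le_max_left |a| |b|
    have := le_max_right |a| |b|
    linarith
  have h0 : 0 ≤ max |a| |b| := le_max_of_le_left (abs_nonneg a)
  refine (Real.rpow_le_rpow (abs_nonneg _) h1 hp).trans ?_
  rw [Real.mul_rpow zero_le_two h0]
  refine mul_le_mul_of_nonneg_left ?_ (by positivity)
  have ha : 0 ≤ |a| ^ p := by positivity
  have hb : 0 ≤ |b| ^ p := by positivity
  rcases max_cases |a| |b| with ⟨h, _⟩ | ⟨h, _⟩ <;> rw [h] <;> linarith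

/-- The integrand of the Gagliardo energy. -/
noncomputable def density {N : ℕ} (s p : ℝ) (u : RN N → ℝ) (z : RN N × RN N) : ℝ :=
  |u z.1 - u z.2| ^ p / ‖z.1 - z.2‖ ^ ((N : ℝ) + s * p)

variable {N : ℕ} {s p lam : ℝ} {u v w : RN N → ℝ}

lemma energy_eq_lintegral_density (u : RN N → ℝ) :
    energy s p u = ∫⁻ z, ENNReal.ofReal (density s p u z) := rfl

lemma density_nonneg (u : RN N → ℝ) (z : RN N × RN N) : 0 ≤ density s p u z := by
  unfold density; positivity

lemma ae_prod_of_ae {P : RN N → Prop} (h : ∀ᵐ x, P x) :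
    ∀ᵐ z : RN N × RN N, P z.1 ∧ P z.2 := by
  have h1 : ∀ᵐ z : RN N × RN N, P z.1 := Measure.quasiMeasurePreserving_fst.ae h
  have h2 : ∀ᵐ z : RN N × RN N, P z.2 := Measure.quasiMeasurePreserving_snd.ae h
  exact h1.and h2

lemma aemeasurable_comp_fst (hu : AEMeasurable u) :
    AEMeasurable (fun z : RN N × RN N => u z.1) :=
  hu.comp_quasiMeasurePreserving Measure.quasiMeasurePreserving_fst

lemma aemeasurable_comp_snd (hu : AEMeasurable u) :
    AEMeasurable (fun z : RN N × RN N => u z.2) :=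
  hu.comp_quasiMeasurePreserving Measure.quasiMeasurePreserving_snd

lemma aemeasurable_diff (hu : AEMeasurable u) :
    AEMeasurable (fun z : RN N × RN N => u z.1 - u z.2) :=
  (aemeasurable_comp_fst hu).sub (aemeasurable_comp_snd hu)

lemma measurable_kernel :
    Measurable (fun z : RN N × RN N => ‖z.1 - z.2‖ ^ ((N : ℝ) + s * p)) := by
  fun_prop

lemma aemeasurable_density (hu : AEMeasurable u) : AEMeasurable (density s p u) := by
  have h1 : AEMeasurable (fun z : RN N × RN N => |u z.1 - u z.2|) :=
    continuous_abs.measurable.comp_aemeasurable (aemeasurable_diff hu)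
  exact (h1.pow_const p).div measurable_kernel.aemeasurable

lemma density_add_le (hp : 0 ≤ p) (u v : RN N → ℝ) (z : RN N × RN N) :
    density s p (fun x => u x + v x) z ≤ 2 ^ p * (density s p u z + density s p v z) := by
  unfold density
  rw [← add_div, ← mul_div_assoc]
  gcongr
  have := abs_add_rpow_le hp (u z.1 - u z.2) (v z.1 - v z.2)
  rwa [show u z.1 - u z.2 + (v z.1 - v z.2) = u z.1 + v z.1 - (u z.2 + v z.2) by ring] at this

lemma energy_add_le (hp : 0 ≤ p) (hu : AEMeasurable u) :
    energy s p (fun x => u x + v x) ≤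
      ENNReal.ofReal (2 ^ p) * (energy s p u + energy s p v) := by
  simp only [energy_eq_lintegral_density]
  rw [← lintegral_add_left' (aemeasurable_density hu).ennreal_ofReal,
    ← lintegral_const_mul' _ _ ENNReal.ofReal_ne_top]
  refine lintegral_mono fun z => ?_
  rw [← ENNReal.ofReal_add (density_nonneg _ _) (density_nonneg _ _),
    ← ENNReal.ofReal_mul (by positivity)]
  exact ENNReal.ofReal_le_ofReal (density_add_le hp u v z)

lemma energy_sub_comm (u v : RN N → ℝ) :
    energy s p (fun x => u x - v x) = energy s p (fun x => v x - u x) := by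
  refine lintegral_congr fun z => ?_
  rw [show u z.1 - v z.1 - (u z.2 - v z.2) = -(v z.1 - u z.1 - (v z.2 - u z.2)) by ring, abs_neg]

/-! ### Finite energy of compactly supported `C¹` functions -/

/-- In polar coordinates the integrand is at most a multiple of `t^(p-1-sp)` near `0`, integrable
because `s < 1`, and of `t^(-1-sp)` at infinity, integrable because `s > 0`. -/
lemma integrable_radial_kernel (hN : 0 < N) (hs0 : 0 < s) (hs1 : s < 1) (hp : 1 < p)
    {L M : ℝ} (hL : 0 ≤ L) (hM : 0 ≤ M) :
    Integrable (fun x : RN N => (min (L * ‖x‖) M) ^ p / ‖x‖ ^ ((N : ℝ) + s * p)) := by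
  have : Nonempty (Fin N) := ⟨⟨0, hN⟩⟩
  have : Nontrivial (RN N) := inferInstance
  have key := integrable_fun_norm_addHaar (E := RN N) volume
    (f := fun t : ℝ => (min (L * t) M) ^ p / t ^ ((N : ℝ) + s * p))
  refine key.2 ?_
  have hdim : Module.finrank ℝ (RN N) = N := by simp
  rw [hdim]
  have hmeas : Measurable fun t : ℝ =>
      t ^ (N - 1) • ((min (L * t) M) ^ p / t ^ ((N : ℝ) + s * p)) := by
    simp only [smul_eq_mul]; fun_prop
  have hpow : ∀ t : ℝ, 0 < t → t ^ (N - 1) / t ^ ((N : ℝ) + s * p) = t ^ (-1 - s * p) := by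
    intro t ht
    rw [← Real.rpow_natCast, ← Real.rpow_sub ht, Nat.cast_sub hN]
    congr 1; push_cast; ring
  have hform : ∀ t : ℝ, 0 < t → ‖t ^ (N - 1) • ((min (L * t) M) ^ p / t ^ ((N : ℝ) + s * p))‖
      = (min (L * t) M) ^ p * t ^ (-1 - s * p) := by
    intro t ht
    have : 0 ≤ min (L * t) M := le_min (by positivity) hM
    rw [Real.norm_of_nonneg (by positivity), smul_eq_mul, ← hpow t ht]
    ring
  rw [← Set.Ioc_union_Ioi_eq_Ioi (zero_le_one' ℝ)]
  refine IntegrableOn.union ?_ ?_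
  · have h1 : IntegrableOn (fun t : ℝ => L ^ p * t ^ (p - 1 - s * p)) (Set.Ioc 0 1) := by
      refine Integrable.const_mul ?_ _
      refine (intervalIntegrable_iff_integrableOn_Ioc_of_le zero_le_one).1
        (intervalIntegral.intervalIntegrable_rpow' ?_)
      nlinarith
    refine Integrable.mono' h1 hmeas.aestronglyMeasurable ?_
    filter_upwards [ae_restrict_mem measurableSet_Ioc] with t ht
    rw [hform t ht.1]
    have : (min (L * t) M) ^ p ≤ (L * t) ^ p :=
      Real.rpow_le_rpow (le_min (mul_nonneg hL ht.1.le) hM) (min_le_left _ _) (by linarith)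
    calc _ ≤ (L * t) ^ p * t ^ (-1 - s * p) := by
          have := Real.rpow_nonneg ht.1.le (-1 - s * p); gcongr
      _ = L ^ p * t ^ (p - 1 - s * p) := by
          rw [Real.mul_rpow hL ht.1.le, mul_assoc, ← Real.rpow_add ht.1]; congr 2; ring
  · have h1 : IntegrableOn (fun t : ℝ => M ^ p * t ^ (-1 - s * p)) (Set.Ioi 1) := by
      refine Integrable.const_mul ?_ _
      refine integrableOn_Ioi_rpow_of_lt ?_ one_pos
      nlinarith
    refine Integrable.mono' h1 hmeas.aestronglyMeasurable ?_
    filter_upwards [ae_restrict_mem measurableSet_Ioi] with t ht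
    have ht0 : 0 < t := one_pos.trans ht
    rw [hform t ht0]
    have : (min (L * t) M) ^ p ≤ M ^ p :=
      Real.rpow_le_rpow (le_min (by positivity) hM) (min_le_right _ _) (by linarith)
    gcongr

lemma energy_ne_top_of_contDiff (hN : 0 < N) (hs0 : 0 < s) (hs1 : s < 1) (hp : 1 < p)
    {φ : RN N → ℝ} (hφ : ContDiff ℝ 1 φ) (hc : HasCompactSupport φ) :
    energy s p φ ≠ ⊤ := by
  obtain ⟨L, hL⟩ := ContDiff.lipschitzWith_of_hasCompactSupport hc hφ one_ne_zero
  obtain ⟨M, hM⟩ := hφ.continuous.bounded_above_of_compact_support hc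
  have hM0 : 0 ≤ M := (norm_nonneg _).trans (hM 0)
  set g : RN N → ℝ≥0∞ := fun x =>
    ENNReal.ofReal ((min (L * ‖x‖) (2 * M)) ^ p / ‖x‖ ^ ((N : ℝ) + s * p)) with hg
  have hgm : Measurable g := by
    rw [hg]; fun_prop
  have hgi : ∫⁻ x, g x ≠ ⊤ :=
    (integrable_radial_kernel hN hs0 hs1 hp L.2 (by positivity : 0 ≤ 2 * M)).lintegral_lt_top.ne
  set K := tsupport φ
  have hK : MeasurableSet K := (isClosed_tsupport φ).measurableSet
  have hKfin : volume K ≠ ⊤ := IsCompact.measure_ne_top hc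
  -- The density vanishes unless one of the two points lies in the support; elsewhere the Lipschitz
  -- and sup bounds dominate it by a function of `z.1 - z.2`, so Tonelli and translation invariance
  -- finish.
  have hbound : ∀ z : RN N × RN N, ENNReal.ofReal (density s p φ z) ≤
      K.indicator 1 z.1 * g (z.1 - z.2) + K.indicator 1 z.2 * g (z.1 - z.2) := by
    intro z
    by_cases h : z.1 ∈ K ∨ z.2 ∈ K
    · have h1 : ENNReal.ofReal (density s p φ z) ≤ g (z.1 - z.2) := by
        refine ENNReal.ofReal_le_ofReal ?_
        unfold density
        have : |φ z.1 - φ z.2| ≤ min (L * ‖z.1 - z.2‖) (2 * M) := by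
          refine le_min ?_ ?_
          · simpa [Real.dist_eq, dist_eq_norm] using hL.dist_le_mul z.1 z.2
          · have := abs_sub (φ z.1) (φ z.2)
            have := hM z.1; have := hM z.2
            simp only [Real.norm_eq_abs] at *
            linarith
        gcongr
      rcases h with h | h
      · refine h1.trans (le_trans ?_ le_self_add)
        simp [Set.indicator_of_mem h]
      · refine h1.trans (le_trans ?_ le_add_self)
        simp [Set.indicator_of_mem h]
    · push Not at h
      have h1 : φ z.1 = 0 := image_eq_zero_of_notMem_tsupport h.1
      have h2 : φ z.2 = 0 := image_eq_zero_of_notMem_tsupport h.2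
      simp [density, h1, h2, Real.zero_rpow (by linarith : p ≠ 0)]
  have hind : Measurable (K.indicator (1 : RN N → ℝ≥0∞)) := measurable_one.indicator hK
  have hKint : ∫⁻ x, K.indicator (1 : RN N → ℝ≥0∞) x = volume K := by
    simp [lintegral_indicator_one hK]
  have hgs : ∀ y : RN N, ∫⁻ x, g (y - x) = ∫⁻ x, g x := fun y => lintegral_sub_left_eq_self g y
  have hgs' : ∀ y : RN N, ∫⁻ x, g (x - y) = ∫⁻ x, g x := fun y => lintegral_sub_right_eq_self g y
  have hm : Measurable fun z : RN N × RN N => g (z.1 - z.2) := hgm.comp (by fun_prop)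
  have hm1 : Measurable fun z : RN N × RN N =>
      K.indicator (1 : RN N → ℝ≥0∞) z.1 * g (z.1 - z.2) :=
    (hind.comp measurable_fst).mul hm
  have hm2 : Measurable fun z : RN N × RN N =>
      K.indicator (1 : RN N → ℝ≥0∞) z.2 * g (z.1 - z.2) :=
    (hind.comp measurable_snd).mul hm
  have h1 : ∫⁻ z : RN N × RN N, K.indicator (1 : RN N → ℝ≥0∞) z.1 * g (z.1 - z.2)
      = volume K * ∫⁻ x, g x := by
    rw [Measure.volume_eq_prod, lintegral_prod _ hm1.aemeasurable]
    have : ∀ x : RN N, ∫⁻ y, K.indicator (1 : RN N → ℝ≥0∞) x * g (x - y)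
        = K.indicator (1 : RN N → ℝ≥0∞) x * ∫⁻ x, g x := by
      intro x
      have hx : Measurable fun y => g (x - y) := hgm.comp (measurable_const.sub measurable_id)
      rw [lintegral_const_mul _ hx, hgs]
    simp only [this]
    rw [lintegral_mul_const _ hind, hKint]
  have h2 : ∫⁻ z : RN N × RN N, K.indicator (1 : RN N → ℝ≥0∞) z.2 * g (z.1 - z.2)
      = volume K * ∫⁻ x, g x := by
    rw [Measure.volume_eq_prod, lintegral_prod_symm _ hm2.aemeasurable]
    have : ∀ y : RN N, ∫⁻ x, K.indicator (1 : RN N → ℝ≥0∞) y * g (x - y)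
        = K.indicator (1 : RN N → ℝ≥0∞) y * ∫⁻ x, g x := by
      intro y
      have hy : Measurable fun x => g (x - y) := hgm.comp (measurable_id.sub measurable_const)
      rw [lintegral_const_mul _ hy, hgs']
    simp only [this]
    rw [lintegral_mul_const _ hind, hKint]
  refine ne_top_of_le_ne_top ?_ (lintegral_mono hbound)
  rw [lintegral_add_left hm1, h1, h2]
  exact ENNReal.add_ne_top.2 ⟨ENNReal.mul_ne_top hKfin hgi, ENNReal.mul_ne_top hKfin hgi⟩

/-! ### First properties of `𝓓^{s,p}(ℝ^N)` -/

lemma MemD.aemeasurable (hu : MemD s p u) : AEMeasurable u := by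
  obtain ⟨φ, hφ, -, hlim⟩ := hu
  exact aemeasurable_of_tendsto_metrizable_ae' (fun n => (hφ n).1.continuous.aemeasurable) hlim

lemma memD_of_contDiff (hp : p ≠ 0) {φ : RN N → ℝ} (hφ : ContDiff ℝ 1 φ)
    (hc : HasCompactSupport φ) : MemD s p φ := by
  refine ⟨fun _ => φ, fun _ => ⟨hφ, hc⟩, ?_, by simp⟩
  simp [energy, Real.zero_rpow hp]

lemma MemD.energy_ne_top (hN : 0 < N) (hs0 : 0 < s) (hs1 : s < 1) (hp : 1 < p)
    (hu : MemD s p u) : energy s p u ≠ ⊤ := by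
  have hum := hu.aemeasurable
  obtain ⟨φ, hφ, hE, -⟩ := hu
  obtain ⟨n, hn⟩ := (hE.eventually (gt_mem_nhds (zero_lt_one))).exists
  have h := energy_add_le (s := s) (u := φ n) (v := fun x => u x - φ n x) (p := p)
    (by linarith) (hφ n).1.continuous.aemeasurable
  simp only [add_sub_cancel] at h
  refine ne_top_of_le_ne_top ?_ h
  refine ENNReal.mul_ne_top ENNReal.ofReal_ne_top (ENNReal.add_ne_top.2 ⟨?_, ?_⟩)
  · exact energy_ne_top_of_contDiff hN hs0 hs1 hp (hφ n).1 (hφ n).2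
  · rw [energy_sub_comm]
    exact (hn.trans ENNReal.one_lt_top).ne

/-! ### Lipschitz functions operate on `𝓓^{s,p}(ℝ^N)` -/

/-- Mollification: an average of translates keeps the Lipschitz constant, and at radius `η / (K +
1)` it moves values by at most `η`. -/
lemma exists_contDiff_lipschitzWith_approx {E : Type*} [NormedAddCommGroup E] [NormedSpace ℝ E]
    [FiniteDimensional ℝ E] [MeasurableSpace E] [BorelSpace E] {Φ : E → ℝ} {K : ℝ≥0}
    (hΦ : LipschitzWith K Φ) {η : ℝ} (hη : 0 < η) :
    ∃ Ψ : E → ℝ, ContDiff ℝ 1 Ψ ∧ LipschitzWith K Ψ ∧ ∀ x, |Ψ x - Φ x| ≤ η := by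
  set μ : Measure E := Measure.addHaar
  set r : ℝ := η / (K + 1) with hr
  have hK1 : (0 : ℝ) < K + 1 := by positivity
  have hr0 : 0 < r := div_pos hη hK1
  let ρ : ContDiffBump (0 : E) := ⟨r / 2, r, by positivity, by linarith⟩
  have hρr : ρ.rOut = r := rfl
  set Ψ : E → ℝ := convolution (ρ.normed μ) Φ (ContinuousLinearMap.lsmul ℝ ℝ) μ with hΨ
  have hform : ∀ x, Ψ x = ∫ t, ρ.normed μ t * Φ (x - t) ∂μ := fun x => rfl
  refine ⟨Ψ, ?_, ?_, ?_⟩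
  · have := HasCompactSupport.contDiff_convolution_left (μ := μ) (n := 1)
      (ContinuousLinearMap.lsmul ℝ ℝ) (ρ.hasCompactSupport_normed (μ := μ))
      (ρ.contDiff_normed (μ := μ)) hΦ.continuous.locallyIntegrable
    exact_mod_cast this
  · have hint : ∀ x, Integrable (fun t => ρ.normed μ t * Φ (x - t)) μ := fun x =>
      Continuous.integrable_of_hasCompactSupport
        (ρ.continuous_normed.mul (hΦ.continuous.comp (continuous_const.sub continuous_id)))
        ρ.hasCompactSupport_normed.mul_right
    refine LipschitzWith.of_dist_le_mul fun x y => ?_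
    rw [Real.dist_eq, hform, hform, ← integral_sub (hint x) (hint y), ← Real.norm_eq_abs]
    have hb : ∀ᵐ t ∂μ, ‖ρ.normed μ t * Φ (x - t) - ρ.normed μ t * Φ (y - t)‖
        ≤ ρ.normed μ t * (K * dist x y) := by
      refine Eventually.of_forall fun t => ?_
      rw [← mul_sub, norm_mul, Real.norm_of_nonneg (ρ.nonneg_normed t)]
      have := hΦ.dist_le_mul (x - t) (y - t)
      rw [dist_sub_right, Real.dist_eq] at this
      exact mul_le_mul_of_nonneg_left this (ρ.nonneg_normed t)
    refine (norm_integral_le_of_norm_le (ρ.integrable_normed.mul_const _) hb).trans ?_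
    rw [integral_mul_const, ρ.integral_normed, one_mul]
  · intro x
    have := ContDiffBump.dist_normed_convolution_le (φ := ρ) (μ := μ) (g := Φ) (x₀ := x) (ε := η)
      hΦ.continuous.aestronglyMeasurable ?_
    · rwa [Real.dist_eq] at this
    · intro y hy
      refine (hΦ.dist_le_mul y x).trans ?_
      have h1 : dist y x ≤ r := (Metric.mem_ball.1 hy).le
      calc (K : ℝ) * dist y x ≤ (K + 1) * r := by gcongr; linarith
        _ = η := by rw [hr]; field_simp

/-- Dominated convergence with a moving majorant: the truncated difference `f n - h n` is dominated
by the fixed `g`, and the remainder `h n` is small in `L¹`. -/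
lemma tendsto_lintegral_zero_of_le_add {α : Type*} [MeasurableSpace α] {μ : Measure α}
    {f h : ℕ → α → ℝ≥0∞} {g : α → ℝ≥0∞} (hf : ∀ n, AEMeasurable (f n) μ)
    (hh : ∀ n, AEMeasurable (h n) μ) (hle : ∀ n, ∀ᵐ x ∂μ, f n x ≤ h n x + g x)
    (hh0 : Tendsto (fun n => ∫⁻ x, h n x ∂μ) atTop (𝓝 0)) (hg : ∫⁻ x, g x ∂μ ≠ ⊤)
    (hlim : ∀ᵐ x ∂μ, Tendsto (fun n => f n x) atTop (𝓝 0)) :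
    Tendsto (fun n => ∫⁻ x, f n x ∂μ) atTop (𝓝 0) := by
  have h1 : Tendsto (fun n => ∫⁻ x, (f n x - h n x) ∂μ) atTop (𝓝 (∫⁻ _, 0 ∂μ)) := by
    refine tendsto_lintegral_of_dominated_convergence' g (fun n => (hf n).sub (hh n)) ?_ hg ?_
    · intro n
      filter_upwards [hle n] with x hx
      exact tsub_le_iff_left.2 hx
    · filter_upwards [hlim] with x hx
      exact tendsto_of_tendsto_of_tendsto_of_le_of_le tendsto_const_nhds hx
        (fun _ => zero_le) (fun _ => tsub_le_self)
  rw [lintegral_zero] at h1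
  have h2 := h1.add hh0
  rw [add_zero] at h2
  refine tendsto_of_tendsto_of_tendsto_of_le_of_le tendsto_const_nhds h2 (fun _ => zero_le) ?_
  intro n
  dsimp only
  rw [← lintegral_add_right' _ (hh n)]
  exact lintegral_mono fun x => le_tsub_add

lemma density_comp_le (hp : 0 ≤ p) {Φ : ℝ × ℝ → ℝ} {K : ℝ≥0} (hΦ : LipschitzWith K Φ)
    (u v : RN N → ℝ) (z : RN N × RN N) :
    density s p (fun x => Φ (u x, v x)) z ≤ K ^ p * (density s p u z + density s p v z) := by
  unfold density
  rw [← add_div, ← mul_div_assoc]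
  gcongr
  have h := hΦ.dist_le_mul (u z.1, v z.1) (u z.2, v z.2)
  rw [Real.dist_eq, Prod.dist_eq, Real.dist_eq, Real.dist_eq] at h
  dsimp only at h
  have h0 : 0 ≤ max |u z.1 - u z.2| |v z.1 - v z.2| := le_max_of_le_left (abs_nonneg _)
  refine (Real.rpow_le_rpow (abs_nonneg _) h hp).trans ?_
  rw [Real.mul_rpow K.coe_nonneg h0]
  have ha : 0 ≤ |u z.1 - u z.2| ^ p := by positivity
  have hb : 0 ≤ |v z.1 - v z.2| ^ p := by positivity
  refine mul_le_mul_of_nonneg_left ?_ (by positivity)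
  rcases max_cases |u z.1 - u z.2| |v z.1 - v z.2| with ⟨h, _⟩ | ⟨h, _⟩ <;> rw [h] <;> linarith

lemma tendsto_density_zero (hp : 0 < p) {f : ℕ → RN N → ℝ} {z : RN N × RN N}
    (h1 : Tendsto (fun n => f n z.1) atTop (𝓝 0)) (h2 : Tendsto (fun n => f n z.2) atTop (𝓝 0)) :
    Tendsto (fun n => density s p (f n) z) atTop (𝓝 0) := by
  have h3 : Tendsto (fun n => |f n z.1 - f n z.2| ^ p) atTop (𝓝 0) := by
    have := (h1.sub h2).abs.rpow_const (p := p) (Or.inr hp.le)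
    simpa [Real.zero_rpow hp.ne'] using this
  simpa [density] using h3.div_const (‖z.1 - z.2‖ ^ ((N : ℝ) + s * p))

/-- The approximants are smoothed versions of `Φ` applied to those of `u` and `v`. Composition with
`Φ` need not be Lipschitz for the seminorm, so energy convergence comes from a.e. convergence of the
densities together with a majorant made of a vanishing part and a fixed integrable part. -/
theorem MemD.comp₂ (hN : 0 < N) (hs0 : 0 < s) (hs1 : s < 1) (hp : 1 < p)
    (hu : MemD s p u) (hv : MemD s p v) {Φ : ℝ × ℝ → ℝ} {K : ℝ≥0}
    (hΦ : LipschitzWith K Φ) (hΦ0 : Φ (0, 0) = 0) :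
    MemD s p (fun x => Φ (u x, v x)) := by
  have hp0 : 0 < p := by linarith
  have hum := hu.aemeasurable
  have hvm := hv.aemeasurable
  have huE := hu.energy_ne_top hN hs0 hs1 hp
  have hvE := hv.energy_ne_top hN hs0 hs1 hp
  obtain ⟨φ, hφ, hφE, hφl⟩ := hu
  obtain ⟨ψ, hψ, hψE, hψl⟩ := hv
  have hη : ∀ n : ℕ, (0 : ℝ) < 1 / (n + 1) := fun n => by positivity
  choose Ψ hΨc hΨL hΨa using fun n => exists_contDiff_lipschitzWith_approx hΦ (hη n)
  -- Normalizing at the origin makes the composites compactly supported; since `Φ (0, 0) = 0` it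
  -- only doubles the error.
  set Θ : ℕ → ℝ × ℝ → ℝ := fun n q => Ψ n q - Ψ n (0, 0) with hΘ
  have hΘL : ∀ n, LipschitzWith K (Θ n) := fun n =>
    LipschitzWith.of_dist_le_mul fun a b => by
      rw [hΘ, dist_sub_right]; exact (hΨL n).dist_le_mul a b
  have hΘ0 : ∀ n, Θ n (0, 0) = 0 := fun n => by simp [hΘ]
  have hΘc : ∀ n, ContDiff ℝ 1 (Θ n) := fun n => (hΨc n).sub contDiff_const
  have hΘa : ∀ n q, |Θ n q - Φ q| ≤ 2 * (1 / ((n : ℝ) + 1)) := by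
    intro n q
    have h1 := hΨa n q
    have h2 := hΨa n (0, 0)
    rw [hΦ0] at h2
    have : Θ n q - Φ q = (Ψ n q - Φ q) - (Ψ n (0, 0) - 0) := by simp only [hΘ]; ring
    rw [this]
    exact (abs_sub _ _).trans (by linarith)
  have hlim : ∀ᵐ x, Tendsto (fun n => Θ n (φ n x, ψ n x)) atTop (𝓝 (Φ (u x, v x))) := by
    filter_upwards [hφl, hψl] with x h1 h2
    have h3 : Tendsto (fun n => Φ (φ n x, ψ n x)) atTop (𝓝 (Φ (u x, v x))) :=
      (hΦ.continuous.tendsto _).comp (h1.prodMk_nhds h2)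
    have h4 : Tendsto (fun n => Θ n (φ n x, ψ n x) - Φ (φ n x, ψ n x)) atTop (𝓝 0) := by
      refine squeeze_zero_norm (fun n => hΘa n _) ?_
      simpa using (tendsto_one_div_add_atTop_nhds_zero_nat (𝕜 := ℝ)).const_mul 2
    simpa using h4.add h3
  have hΦm : AEMeasurable (fun x => Φ (u x, v x)) :=
    hΦ.continuous.measurable.comp_aemeasurable (hum.prodMk hvm)
  have hφm : ∀ n, AEMeasurable (φ n) := fun n => (hφ n).1.continuous.aemeasurable
  have hψm : ∀ n, AEMeasurable (ψ n) := fun n => (hψ n).1.continuous.aemeasurable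
  have hχm : ∀ n, AEMeasurable (fun x => Θ n (φ n x, ψ n x)) := fun n =>
    (hΘL n).continuous.measurable.comp_aemeasurable ((hφm n).prodMk (hψm n))
  refine ⟨fun n x => Θ n (φ n x, ψ n x), fun n => ⟨?_, ?_⟩, ?_, hlim⟩
  · exact (hΘc n).comp ((hφ n).1.prodMk (hψ n).1)
  · exact HasCompactSupport.comp₂_left (m := fun a b => Θ n (a, b)) (hφ n).2 (hψ n).2 (hΘ0 n)
  set C : ℝ := 2 ^ p * (K ^ p * 2 ^ p + K ^ p) with hC
  have hC0 : 0 ≤ C := by positivity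
  refine tendsto_lintegral_zero_of_le_add
    (h := fun n z => ENNReal.ofReal C * (ENNReal.ofReal (density s p (fun x => φ n x - u x) z)
      + ENNReal.ofReal (density s p (fun x => ψ n x - v x) z)))
    (g := fun z => ENNReal.ofReal C * (ENNReal.ofReal (density s p u z)
      + ENNReal.ofReal (density s p v z))) ?_ ?_ ?_ ?_ ?_ ?_
  · exact fun n => (aemeasurable_density ((hχm n).sub hΦm)).ennreal_ofReal
  · exact fun n => (((aemeasurable_density ((hφm n).sub hum)).ennreal_ofReal).add
      (aemeasurable_density ((hψm n).sub hvm)).ennreal_ofReal).const_mul _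
  · refine fun n => Eventually.of_forall fun z => ?_
    have d0 := fun w : RN N → ℝ => density_nonneg (s := s) (p := p) w z
    rw [← ENNReal.ofReal_add (d0 _) (d0 _), ← ENNReal.ofReal_add (d0 _) (d0 _),
      ← ENNReal.ofReal_mul hC0, ← ENNReal.ofReal_mul hC0,
      ← ENNReal.ofReal_add (mul_nonneg hC0 (add_nonneg (d0 _) (d0 _)))
        (mul_nonneg hC0 (add_nonneg (d0 _) (d0 _)))]
    refine ENNReal.ofReal_le_ofReal ?_
    change density s p (fun x => Θ n (φ n x, ψ n x) - Φ (u x, v x)) z ≤ _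
    have e1 := density_add_le (s := s) hp0.le (fun x => Θ n (φ n x, ψ n x))
      (fun x => -Φ (u x, v x)) z
    have e2 : density s p (fun x => -Φ (u x, v x)) z ≤
        K ^ p * (density s p u z + density s p v z) := density_comp_le hp0.le hΦ.neg u v z
    have e3 := density_comp_le (s := s) hp0.le (hΘL n) (φ n) (ψ n) z
    have e4 := density_add_le (s := s) hp0.le (fun x => φ n x - u x) u z
    have e5 := density_add_le (s := s) hp0.le (fun x => ψ n x - v x) v z
    simp only [sub_add_cancel] at e4 e5
    simp only [← sub_eq_add_neg] at e1
    have hKp : (0 : ℝ) ≤ (K : ℝ) ^ p := by positivity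
    have h2p : (0 : ℝ) ≤ 2 ^ p := by positivity
    calc _ ≤ _ := e1
      _ ≤ 2 ^ p * (K ^ p * (2 ^ p * (density s p (fun x => φ n x - u x) z + density s p u z)
            + 2 ^ p * (density s p (fun x => ψ n x - v x) z + density s p v z))
            + K ^ p * (density s p u z + density s p v z)) := by
          refine mul_le_mul_of_nonneg_left (add_le_add (e3.trans ?_) e2) h2p
          exact mul_le_mul_of_nonneg_left (add_le_add e4 e5) hKp
      _ ≤ _ := by
          have a1 := d0 (fun x => φ n x - u x)
          have a2 := d0 (fun x => ψ n x - v x)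
          have : 0 ≤ 2 ^ p * K ^ p * (density s p (fun x => φ n x - u x) z
            + density s p (fun x => ψ n x - v x) z) := by positivity
          rw [hC]
          linarith
  · have : Tendsto (fun n => ENNReal.ofReal C * (energy s p (fun x => φ n x - u x)
        + energy s p (fun x => ψ n x - v x))) atTop (𝓝 0) := by
      have := ENNReal.Tendsto.const_mul (hφE.add hψE) (Or.inr (ENNReal.ofReal_ne_top (r := C)))
      simpa using this
    refine this.congr fun n => ?_
    have hm : AEMeasurable (density s p fun x => φ n x - u x) :=
      aemeasurable_density ((hφm n).sub hum)
    rw [lintegral_const_mul' _ _ ENNReal.ofReal_ne_top, lintegral_add_left' hm.ennreal_ofReal]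
    rfl
  · rw [lintegral_const_mul' _ _ ENNReal.ofReal_ne_top,
      lintegral_add_left' (aemeasurable_density hum).ennreal_ofReal]
    exact ENNReal.mul_ne_top ENNReal.ofReal_ne_top (ENNReal.add_ne_top.2 ⟨huE, hvE⟩)
  · filter_upwards [ae_prod_of_ae hlim] with z hz
    have h1 := hz.1.sub_const (Φ (u z.1, v z.1))
    have h2 := hz.2.sub_const (Φ (u z.2, v z.2))
    rw [sub_self] at h1 h2
    have := tendsto_density_zero (s := s) hp0
      (f := fun n x => Θ n (φ n x, ψ n x) - Φ (u x, v x)) h1 h2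
    have h3 := ENNReal.tendsto_ofReal this
    rw [ENNReal.ofReal_zero] at h3
    exact h3

lemma MemD.neg (hu : MemD s p u) : MemD s p (fun x => -u x) := by
  obtain ⟨φ, hφ, hE, hl⟩ := hu
  refine ⟨fun n x => -φ n x, fun n => ⟨(hφ n).1.neg, (hφ n).2.neg⟩, ?_, ?_⟩
  · refine hE.congr fun n => ?_
    rw [energy_sub_comm]
    congr 1; ext x; ring
  · filter_upwards [hl] with x hx using hx.neg

lemma MemD.const_mul (hN : 0 < N) (hs0 : 0 < s) (hs1 : s < 1) (hp : 1 < p)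
    (hu : MemD s p u) (c : ℝ) : MemD s p (fun x => c * u x) := by
  refine hu.comp₂ hN hs0 hs1 hp hu (Φ := fun q => c * q.1) (K := ‖c‖₊) ?_ (by simp)
  refine LipschitzWith.of_dist_le_mul fun a b => ?_
  rw [Real.dist_eq, ← mul_sub, abs_mul, coe_nnnorm, Real.norm_eq_abs]
  gcongr
  rw [← Real.dist_eq]
  exact le_max_left _ _

lemma energy_const_mul {c : ℝ} (hc : 0 ≤ c) (u : RN N → ℝ) :
    energy s p (fun x => c * u x) = ENNReal.ofReal (c ^ p) * energy s p u := by
  simp only [energy]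
  rw [← lintegral_const_mul' _ _ ENNReal.ofReal_ne_top]
  refine lintegral_congr fun z => ?_
  rw [← ENNReal.ofReal_mul (by positivity), ← mul_sub, abs_mul, abs_of_nonneg hc,
    Real.mul_rpow hc (abs_nonneg _), mul_div_assoc]

/-! ### Elements of `𝓓^{s,p}(ℝ^N)` of zero energy vanish -/

/-- A substitute for Hölder's inequality that keeps a free parameter: if `a ≥ δ`, then `a = a^(1-p)
a^p ≤ δ^(1-p) a^p`. -/
lemma le_add_rpow_mul_rpow {p : ℝ} (hp : 1 ≤ p) {a δ : ℝ} (ha : 0 ≤ a) (hδ : 0 < δ) :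
    a ≤ δ + δ ^ (1 - p) * a ^ p := by
  have h0 : 0 ≤ δ ^ (1 - p) * a ^ p := by positivity
  rcases le_total a δ with h | h
  · linarith
  · have ha' : 0 < a := hδ.trans_le h
    have h1 : a ^ (1 - p) * a ^ p = a := by
      rw [← Real.rpow_add ha']; simp
    have h2 : a ^ (1 - p) ≤ δ ^ (1 - p) := Real.rpow_le_rpow_of_nonpos hδ h (by linarith)
    have h3 : a ^ (1 - p) * a ^ p ≤ δ ^ (1 - p) * a ^ p := by gcongr
    linarith

lemma abs_sub_le_add_density (hs0 : 0 ≤ s) (hp : 1 ≤ p) {R δ : ℝ} (hδ : 0 < δ) (φ : RN N → ℝ)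
    {x y : RN N} (hxy : ‖x - y‖ ≤ R) :
    |φ x - φ y| ≤ δ + δ ^ (1 - p) * R ^ ((N : ℝ) + s * p) * density s p φ (x, y) := by
  refine (le_add_rpow_mul_rpow hp (abs_nonneg _) hδ).trans ?_
  rw [mul_assoc]
  have hR : 0 ≤ R := (norm_nonneg _).trans hxy
  gcongr
  rcases eq_or_ne x y with rfl | hne
  · rw [sub_self, abs_zero, Real.zero_rpow (by linarith)]
    exact mul_nonneg (by positivity) (density_nonneg _ _)
  · have hpos : 0 < ‖x - y‖ := norm_pos_iff.2 (sub_ne_zero.2 hne)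
    have hle : ‖x - y‖ ^ ((N : ℝ) + s * p) ≤ R ^ ((N : ℝ) + s * p) :=
      Real.rpow_le_rpow hpos.le hxy (by positivity)
    calc |φ x - φ y| ^ p = ‖x - y‖ ^ ((N : ℝ) + s * p) * density s p φ (x, y) := by
          unfold density
          have := Real.rpow_pos_of_pos hpos ((N : ℝ) + s * p)
          field_simp
      _ ≤ _ := mul_le_mul_of_nonneg_right hle (density_nonneg _ _)

/-- Integration over the product of the two balls of `|φ x| ≤ |φ y| + |φ x - φ y|`, the last term
being controlled by the density. It compares the means of `|φ|` over the two balls. -/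
lemma lintegral_ball_step (hs0 : 0 ≤ s) (hp : 1 ≤ p) {φ : RN N → ℝ} (hφ : Continuous φ)
    {R R' δ : ℝ} (hδ : 0 < δ) :
    volume (Metric.ball (0 : RN N) R') * ∫⁻ x in Metric.ball (0 : RN N) R, ENNReal.ofReal |φ x| ≤
      volume (Metric.ball (0 : RN N) R) * volume (Metric.ball (0 : RN N) R') * ENNReal.ofReal δ
      + ENNReal.ofReal (δ ^ (1 - p) * (R + R') ^ ((N : ℝ) + s * p)) * energy s p φ
      + volume (Metric.ball (0 : RN N) R) *
        ∫⁻ x in Metric.ball (0 : RN N) R', ENNReal.ofReal |φ x| := by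
  set B := Metric.ball (0 : RN N) R
  set B' := Metric.ball (0 : RN N) R'
  set c : ℝ≥0∞ := ENNReal.ofReal (δ ^ (1 - p) * (R + R') ^ ((N : ℝ) + s * p))
  set A' := ∫⁻ x in B', ENNReal.ofReal |φ x|
  have hdm : Measurable (density s p φ) := by
    unfold density; have := hφ.measurable; fun_prop
  have hdm' : ∀ x, Measurable fun y => ENNReal.ofReal (density s p φ (x, y)) := fun x =>
    (hdm.comp measurable_prodMk_left).ennreal_ofReal
  have hpt : ∀ x ∈ B, ∀ y ∈ B', ENNReal.ofReal |φ x| ≤ ENNReal.ofReal δ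
      + c * ENNReal.ofReal (density s p φ (x, y)) + ENNReal.ofReal |φ y| := by
    intro x hx y hy
    have hxy : ‖x - y‖ ≤ R + R' := by
      have h1 := mem_ball_zero_iff.1 hx
      have h2 := mem_ball_zero_iff.1 hy
      linarith [norm_sub_le x y]
    have hRR : 0 ≤ R + R' := (norm_nonneg _).trans hxy
    have hd := density_nonneg (s := s) (p := p) φ (x, y)
    rw [← ENNReal.ofReal_mul (by positivity), ← ENNReal.ofReal_add hδ.le (by positivity),
      ← ENNReal.ofReal_add (by positivity) (abs_nonneg _)]
    refine ENNReal.ofReal_le_ofReal ?_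
    have h1 := abs_sub_le_add_density hs0 hp hδ φ hxy
    have h2 := abs_sub_abs_le_abs_sub (φ x) (φ y)
    linarith
  have hx : ∀ x ∈ B, volume B' * ENNReal.ofReal |φ x| ≤ volume B' * ENNReal.ofReal δ
      + c * (∫⁻ y, ENNReal.ofReal (density s p φ (x, y))) + A' := by
    intro x hx
    calc volume B' * ENNReal.ofReal |φ x| = ∫⁻ _ in B', ENNReal.ofReal |φ x| := by
          rw [setLIntegral_const, mul_comm]
      _ ≤ ∫⁻ y in B', (ENNReal.ofReal δ
            + c * ENNReal.ofReal (density s p φ (x, y)) + ENNReal.ofReal |φ y|) :=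
          setLIntegral_mono' Metric.isOpen_ball.measurableSet fun y hy => hpt x hx y hy
      _ = volume B' * ENNReal.ofReal δ
            + c * (∫⁻ y in B', ENNReal.ofReal (density s p φ (x, y))) + A' := by
          have h1 : Measurable fun y => ENNReal.ofReal δ
              + c * ENNReal.ofReal (density s p φ (x, y)) :=
            measurable_const.add ((hdm' x).const_mul c)
          rw [lintegral_add_left h1, lintegral_add_left measurable_const, setLIntegral_const,
            lintegral_const_mul _ (hdm' x), mul_comm (ENNReal.ofReal δ)]
      _ ≤ _ := by
          gcongr
          exact Measure.restrict_le_self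
  have hjm : Measurable fun x => ∫⁻ y, ENNReal.ofReal (density s p φ (x, y)) :=
    hdm.ennreal_ofReal.lintegral_prod_right'
  have hE : ∫⁻ x, ∫⁻ y, ENNReal.ofReal (density s p φ (x, y)) = energy s p φ := by
    rw [energy_eq_lintegral_density, Measure.volume_eq_prod,
      lintegral_prod _ hdm.ennreal_ofReal.aemeasurable]
  calc volume B' * ∫⁻ x in B, ENNReal.ofReal |φ x|
      = ∫⁻ x in B, volume B' * ENNReal.ofReal |φ x| := by
        rw [lintegral_const_mul _ (by have := hφ.measurable; fun_prop)]
    _ ≤ ∫⁻ x in B, (volume B' * ENNReal.ofReal δ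
          + c * (∫⁻ y, ENNReal.ofReal (density s p φ (x, y))) + A') :=
        setLIntegral_mono' Metric.isOpen_ball.measurableSet hx
    _ = volume B * volume B' * ENNReal.ofReal δ
          + c * (∫⁻ x in B, ∫⁻ y, ENNReal.ofReal (density s p φ (x, y))) + volume B * A' := by
        rw [lintegral_add_right _ measurable_const, lintegral_add_left measurable_const,
          setLIntegral_const, setLIntegral_const, lintegral_const_mul _ hjm]
        ring
    _ ≤ _ := by
        rw [← hE]
        gcongr
        exact Measure.restrict_le_self

/-- Telescoping over dyadic balls: the mean over radius `2^j` is the sum of successive differences,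
because the means of an integrable function over growing balls tend to `0`. The differences decay
geometrically since `s * p < N`. -/
lemma average_ball_le_of_continuous (hN : 0 < N) (hs0 : 0 < s) (hp : 1 < p)
    (hsp : s * p < N) :
    ∃ c r : ℝ, 0 ≤ r ∧ r < 1 ∧ ∀ φ : RN N → ℝ, Continuous φ → HasCompactSupport φ →
      energy s p φ ≠ ⊤ → ∀ j : ℕ, ∀ τ : ℝ, 0 < τ →
      (∫⁻ x in Metric.ball (0 : RN N) (2 ^ j), ENNReal.ofReal |φ x|).toReal ≤
        (volume (Metric.ball (0 : RN N) (2 ^ j))).toReal *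
          ((τ + τ ^ (1 - p) * c * (energy s p φ).toReal) / (1 - r)) := by
  have : Nonempty (Fin N) := ⟨⟨0, hN⟩⟩
  have : Nontrivial (RN N) := inferInstance
  have hp0 : 0 < p := by linarith
  set β : ℝ := (volume (Metric.ball (0 : RN N) 1)).toReal with hβ
  have hβ0 : 0 < β := ENNReal.toReal_pos (Metric.measure_ball_pos _ _ one_pos).ne'
    measure_ball_lt_top.ne
  set r : ℝ := 2 ^ ((s * p - N) / p) with hr
  have hr0 : 0 < r := by positivity
  have hr1 : r < 1 := Real.rpow_lt_one_of_one_lt_of_neg one_lt_two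
    (div_neg_of_neg_of_pos (by linarith) hp0)
  have hrp : r ^ p = 2 ^ (s * p - N) := by
    rw [hr, ← Real.rpow_mul zero_le_two]; congr 1; field_simp
  set c : ℝ := 4 ^ ((N : ℝ) + s * p) / (2 ^ N * β ^ 2) with hc
  have hc0 : 0 < c := by positivity
  refine ⟨c, r, hr0.le, hr1, fun φ hφ hcs hE j τ hτ => ?_⟩
  set a : ℕ → ℝ := fun k =>
    (∫⁻ x in Metric.ball (0 : RN N) (2 ^ k), ENNReal.ofReal |φ x|).toReal with ha
  set b : ℕ → ℝ := fun k => (volume (Metric.ball (0 : RN N) (2 ^ k))).toReal with hb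
  set e : ℝ := (energy s p φ).toReal with he
  have he0 : 0 ≤ e := ENNReal.toReal_nonneg
  have hbk : ∀ k, b k = (2 ^ k) ^ N * β := by
    intro k
    simp only [hb]
    rw [Measure.addHaar_ball _ _ (by positivity), ENNReal.toReal_mul,
      ENNReal.toReal_ofReal (by positivity)]
    simp [hβ]
  have hb0 : ∀ k, 0 < b k := fun k => by rw [hbk]; positivity
  have hL1 : ∫⁻ x, ENNReal.ofReal |φ x| ≠ ⊤ :=
    (hφ.integrable_of_hasCompactSupport hcs).abs.lintegral_lt_top.ne
  have hAle : ∀ k : ℕ, ∫⁻ x in Metric.ball (0 : RN N) (2 ^ k), ENNReal.ofReal |φ x| ≤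
      ∫⁻ x, ENNReal.ofReal |φ x| := fun k => setLIntegral_le_lintegral _ _
  have hAfin : ∀ k : ℕ, ∫⁻ x in Metric.ball (0 : RN N) (2 ^ k), ENNReal.ofReal |φ x| ≠ ⊤ :=
    fun k => ne_top_of_le_ne_top hL1 (hAle k)
  set T : ℝ := τ + τ ^ (1 - p) * c * e with hT
  have hT0 : 0 ≤ T := by positivity
  have hstep : ∀ k, a k / b k ≤ a (k + 1) / b (k + 1) + r ^ k * T := by
    intro k
    -- At scale `2^k` the energy term is of order `δ^(1-p) 2^(k(sp-N)) = δ^(1-p) r^(kp)`. This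
    -- choice turns both error terms into multiples of `r^k`.
    set δ : ℝ := τ * r ^ k with hδ
    have hδ0 : 0 < δ := by positivity
    have h := lintegral_ball_step hs0.le hp.le hφ (R := 2 ^ k) (R' := 2 ^ (k + 1)) hδ0
    have hBfin : ∀ k : ℕ, volume (Metric.ball (0 : RN N) (2 ^ k)) ≠ ⊤ := fun k =>
      measure_ball_lt_top.ne
    have h' := ENNReal.toReal_mono ?_ h
    swap
    · exact ENNReal.add_ne_top.2 ⟨ENNReal.add_ne_top.2
        ⟨ENNReal.mul_ne_top (ENNReal.mul_ne_top (hBfin _) (hBfin _)) ENNReal.ofReal_ne_top,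
          ENNReal.mul_ne_top ENNReal.ofReal_ne_top hE⟩,
        ENNReal.mul_ne_top (hBfin _) (hAfin _)⟩
    rw [ENNReal.toReal_add (ENNReal.add_ne_top.2
        ⟨ENNReal.mul_ne_top (ENNReal.mul_ne_top (hBfin _) (hBfin _)) ENNReal.ofReal_ne_top,
          ENNReal.mul_ne_top ENNReal.ofReal_ne_top hE⟩)
        (ENNReal.mul_ne_top (hBfin _) (hAfin _)),
      ENNReal.toReal_add
        (ENNReal.mul_ne_top (ENNReal.mul_ne_top (hBfin _) (hBfin _)) ENNReal.ofReal_ne_top)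
        (ENNReal.mul_ne_top ENNReal.ofReal_ne_top hE)] at h'
    simp only [ENNReal.toReal_mul] at h'
    rw [ENNReal.toReal_ofReal hδ0.le, ENNReal.toReal_ofReal (by positivity)] at h'
    change b (k + 1) * a k ≤ b k * b (k + 1) * δ
      + δ ^ (1 - p) * (2 ^ k + 2 ^ (k + 1)) ^ ((N : ℝ) + s * p) * e + b k * a (k + 1) at h'
    have hkey : δ ^ (1 - p) * (2 ^ k + 2 ^ (k + 1)) ^ ((N : ℝ) + s * p) * e ≤
        b k * b (k + 1) * (r ^ k * (τ ^ (1 - p) * c * e)) := by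
      have h2k : (2 : ℝ) ^ k + 2 ^ (k + 1) ≤ 4 * 2 ^ k := by
        have : (0 : ℝ) < 2 ^ k := by positivity
        rw [pow_succ]; linarith
      have h3 : ((2 : ℝ) ^ k + 2 ^ (k + 1)) ^ ((N : ℝ) + s * p) ≤
          4 ^ ((N : ℝ) + s * p) * ((2 : ℝ) ^ k) ^ ((N : ℝ) + s * p) := by
        rw [← Real.mul_rpow (by norm_num) (by positivity)]
        exact Real.rpow_le_rpow (by positivity) h2k (by positivity)
      have h4 : δ ^ (1 - p) = τ ^ (1 - p) * (r ^ k * ((2 : ℝ) ^ k) ^ ((N : ℝ) - s * p)) := by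
        rw [hδ, Real.mul_rpow hτ.le (by positivity)]
        congr 1
        rw [Real.rpow_sub (by positivity), Real.rpow_one, div_eq_mul_inv]
        congr 1
        rw [← Real.rpow_natCast r k, ← Real.rpow_mul hr0.le, mul_comm (k : ℝ),
          Real.rpow_mul hr0.le, hrp, ← Real.rpow_neg (by positivity), ← Real.rpow_natCast 2 k,
          ← Real.rpow_mul zero_le_two, ← Real.rpow_mul zero_le_two]
        congr 1; ring
      have h5 : ((2 : ℝ) ^ k) ^ ((N : ℝ) - s * p) * ((2 : ℝ) ^ k) ^ ((N : ℝ) + s * p)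
          = (2 ^ k) ^ N * (2 ^ k) ^ N := by
        rw [← Real.rpow_add (by positivity), ← Real.rpow_natCast (2 ^ k) N,
          ← Real.rpow_add (by positivity)]
        congr 1; ring
      calc δ ^ (1 - p) * (2 ^ k + 2 ^ (k + 1)) ^ ((N : ℝ) + s * p) * e
          ≤ δ ^ (1 - p) * (4 ^ ((N : ℝ) + s * p) * ((2 : ℝ) ^ k) ^ ((N : ℝ) + s * p)) * e := by
            gcongr
        _ = τ ^ (1 - p) * r ^ k * 4 ^ ((N : ℝ) + s * p) * e *
            (((2 : ℝ) ^ k) ^ ((N : ℝ) - s * p) * ((2 : ℝ) ^ k) ^ ((N : ℝ) + s * p)) := by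
            rw [h4]; ring
        _ = b k * b (k + 1) * (r ^ k * (τ ^ (1 - p) * c * e)) := by
            rw [h5, hbk, hbk, hc, pow_succ 2 k, mul_pow]
            field_simp
    have hbk0 := hb0 k
    have hbk1 := hb0 (k + 1)
    rw [div_add' _ _ _ hbk1.ne', div_le_div_iff₀ hbk0 hbk1]
    calc a k * b (k + 1) ≤ b k * b (k + 1) * δ
          + b k * b (k + 1) * (r ^ k * (τ ^ (1 - p) * c * e)) + b k * a (k + 1) := by linarith
      _ = _ := by rw [hδ, hT]; ring
  have htel : ∀ m, a j / b j ≤ a (j + m) / b (j + m) + T / (1 - r) := by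
    have hsum : ∀ m, a j / b j ≤ a (j + m) / b (j + m) + T * ∑ i ∈ Finset.range m, r ^ i := by
      intro m
      induction m with
      | zero => simp
      | succ m ih =>
        rw [Finset.sum_range_succ, mul_add, ← add_assoc j m 1]
        have h1 := hstep (j + m)
        have h2 : r ^ (j + m) * T ≤ T * r ^ m := by
          rw [mul_comm]
          exact mul_le_mul_of_nonneg_left
            (pow_le_pow_of_le_one hr0.le hr1.le (Nat.le_add_left m j)) hT0
        linarith
    intro m
    refine (hsum m).trans ?_
    rw [div_eq_mul_inv T]
    gcongr
    rw [← tsum_geometric_of_lt_one hr0.le hr1]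
    exact (summable_geometric_of_lt_one hr0.le hr1).sum_le_tsum _ fun i _ => by positivity
  have hlim : Tendsto (fun m => a (j + m) / b (j + m)) atTop (𝓝 0) := by
    have hbtop : Tendsto (fun m => b (j + m)) atTop atTop := by
      have h1 : Tendsto (fun k => b k) atTop atTop := by
        refine tendsto_atTop_mono (f := fun k : ℕ => (2 : ℝ) ^ k * β) (fun k => ?_)
          ((tendsto_pow_atTop_atTop_of_one_lt one_lt_two).atTop_mul_const hβ0)
        rw [hbk]
        gcongr
        exact le_self_pow₀ (one_le_pow₀ one_le_two) hN.ne'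
      refine (h1.comp (tendsto_add_atTop_nat j)).congr fun m => ?_
      rw [Function.comp_apply, add_comm]
    refine squeeze_zero (fun m => div_nonneg ENNReal.toReal_nonneg (hb0 _).le) (fun m => ?_)
      (Tendsto.const_div_atTop hbtop (∫⁻ x, ENNReal.ofReal |φ x|).toReal)
    exact div_le_div_of_nonneg_right (ENNReal.toReal_mono hL1 (hAle _)) (hb0 _).le
  have hfin : a j / b j ≤ T / (1 - r) := by
    have := ge_of_tendsto' (hlim.add_const (T / (1 - r))) htel
    simpa using this
  rw [div_le_iff₀ (hb0 j), mul_comm] at hfin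
  exact hfin

/-- The energies of the approximants tend to `0`, so the dyadic estimate bounds their `L¹` norms on
a fixed ball asymptotically by a multiple of the free parameter `τ`, hence they vanish in the limit;
Fatou passes this to `u`. Nonzero constants are thereby excluded. -/
theorem MemD.ae_eq_zero_of_energy_eq_zero (hN : 0 < N) (hs0 : 0 < s) (hs1 : s < 1) (hp : 1 < p)
    (hsp : s * p < N) (hu : MemD s p u) (hE : energy s p u = 0) : ∀ᵐ x, u x = 0 := by
  have hum := hu.aemeasurable
  obtain ⟨φ, hφ, hφE, hlim⟩ := hu
  obtain ⟨c, r, hr0, hr1, hbd⟩ := average_ball_le_of_continuous hN hs0 hp hsp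
  have hfin : ∀ n, energy s p (φ n) ≠ ⊤ := fun n =>
    energy_ne_top_of_contDiff hN hs0 hs1 hp (hφ n).1 (hφ n).2
  have hE0 : Tendsto (fun n => energy s p (φ n)) atTop (𝓝 0) := by
    have h1 : Tendsto (fun n => ENNReal.ofReal (2 ^ p) * energy s p (fun x => φ n x - u x))
        atTop (𝓝 0) := by
      simpa using ENNReal.Tendsto.const_mul hφE (Or.inr (ENNReal.ofReal_ne_top (r := 2 ^ p)))
    refine tendsto_of_tendsto_of_tendsto_of_le_of_le tendsto_const_nhds h1
      (fun _ => zero_le) fun n => ?_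
    have h := energy_add_le (s := s) (p := p) (u := fun x => φ n x - u x) (v := u) (by linarith)
      ((hφ n).1.continuous.aemeasurable.sub hum)
    simpa [hE] using h
  have he0 : Tendsto (fun n => (energy s p (φ n)).toReal) atTop (𝓝 0) := by
    exact (ENNReal.tendsto_toReal ENNReal.zero_ne_top).comp hE0
  have hball : ∀ j : ℕ, ∀ᵐ x ∂(volume.restrict (Metric.ball (0 : RN N) (2 ^ j))), u x = 0 := by
    intro j
    set B := Metric.ball (0 : RN N) (2 ^ j)
    have hAfin : ∀ n, ∫⁻ x in B, ENNReal.ofReal |φ n x| ≠ ⊤ := fun n =>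
      ne_top_of_le_ne_top (((hφ n).1.continuous.integrable_of_hasCompactSupport
        (hφ n).2).abs.lintegral_lt_top.ne) (setLIntegral_le_lintegral _ _)
    have hA0 : Tendsto (fun n => (∫⁻ x in B, ENNReal.ofReal |φ n x|).toReal) atTop (𝓝 0) := by
      have hub : ∀ τ : ℝ, 0 < τ → ∀ᶠ n in atTop,
          (∫⁻ x in B, ENNReal.ofReal |φ n x|).toReal <
            (volume B).toReal * (τ / (1 - r)) + τ := by
        intro τ hτ
        have h1 : Tendsto (fun n => (volume B).toReal *
            ((τ + τ ^ (1 - p) * c * (energy s p (φ n)).toReal) / (1 - r))) atTop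
            (𝓝 ((volume B).toReal * (τ / (1 - r)))) := by
          have := (((he0.const_mul (τ ^ (1 - p) * c)).const_add τ).div_const (1 - r)).const_mul
            (volume B).toReal
          simpa using this
        filter_upwards [h1.eventually (gt_mem_nhds (lt_add_of_pos_right _ hτ))] with n hn
        exact (hbd (φ n) (hφ n).1.continuous (hφ n).2 (hfin n) j τ hτ).trans_lt hn
      have hc0 : 0 < (volume B).toReal / (1 - r) + 1 := by
        have : 0 < 1 - r := by linarith
        positivity
      rw [Metric.tendsto_atTop']
      intro ε hε
      obtain ⟨n₀, hn₀⟩ := eventually_atTop.1 (hub (ε / ((volume B).toReal / (1 - r) + 1))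
        (by positivity))
      refine ⟨n₀, fun n hn => ?_⟩
      rw [Real.dist_eq, sub_zero, abs_of_nonneg ENNReal.toReal_nonneg]
      refine (hn₀ n hn.le).trans_eq ?_
      field_simp
    have hA0' : Tendsto (fun n => ∫⁻ x in B, ENNReal.ofReal |φ n x|) atTop (𝓝 0) := by
      rw [← ENNReal.tendsto_toReal_iff hAfin ENNReal.zero_ne_top]
      simpa using hA0
    have hfatou : ∫⁻ x in B, ENNReal.ofReal |u x| ≤ 0 := by
      calc ∫⁻ x in B, ENNReal.ofReal |u x|
          = ∫⁻ x in B, liminf (fun n => ENNReal.ofReal |φ n x|) atTop := by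
            refine lintegral_congr_ae (ae_restrict_of_ae ?_)
            filter_upwards [hlim] with x hx
            exact (ENNReal.tendsto_ofReal hx.abs).liminf_eq.symm
        _ ≤ liminf (fun n => ∫⁻ x in B, ENNReal.ofReal |φ n x|) atTop :=
            lintegral_liminf_le fun n => (hφ n).1.continuous.abs.measurable.ennreal_ofReal
        _ = 0 := hA0'.liminf_eq
    have h0 := (lintegral_eq_zero_iff' (hum.restrict.norm.ennreal_ofReal)).1 (le_zero_iff.1 hfatou)
    filter_upwards [h0] with x hx
    simpa using hx
  have hcover : (⋃ j : ℕ, Metric.ball (0 : RN N) (2 ^ j)) = Set.univ := by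
    refine Set.eq_univ_of_forall fun x => Set.mem_iUnion.2 ?_
    obtain ⟨j, hj⟩ := pow_unbounded_of_one_lt ‖x‖ (one_lt_two (α := ℝ))
    exact ⟨j, mem_ball_zero_iff.2 hj⟩
  have := (ae_restrict_iUnion_iff (fun j : ℕ => Metric.ball (0 : RN N) (2 ^ j))
    (fun x => u x = 0)).2 hball
  rwa [hcover, Measure.restrict_univ] at this

/-! ### The weak form -/

/-- The integrand of the weak form. -/
noncomputable def weakIntegrand (s p : ℝ) (u v : RN N → ℝ) (z : RN N × RN N) : ℝ :=
  |u z.1 - u z.2| ^ (p - 2) * (u z.1 - u z.2) * (v z.1 - v z.2) /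
    ‖z.1 - z.2‖ ^ ((N : ℝ) + s * p)

lemma weakForm_eq_integral (u v : RN N → ℝ) :
    weakForm s p u v = ∫ z, weakIntegrand s p u v z := rfl

lemma abs_rpow_sub_two_mul_abs {p : ℝ} (hp : 1 < p) (a : ℝ) :
    |a| ^ (p - 2) * |a| = |a| ^ (p - 1) := by
  rcases eq_or_ne a 0 with rfl | ha
  · simp [Real.zero_rpow (by linarith : p - 1 ≠ 0)]
  · have := abs_pos.2 ha
    rw [← Real.rpow_add_one this.ne']; congr 1; ring

lemma abs_rpow_sub_two_mul_mul_self {p : ℝ} (hp : 1 < p) (a : ℝ) :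
    |a| ^ (p - 2) * a * a = |a| ^ p := by
  rw [mul_assoc, ← abs_mul_abs_self, ← mul_assoc, abs_rpow_sub_two_mul_abs hp]
  rcases eq_or_ne a 0 with rfl | ha
  · simp [Real.zero_rpow (by linarith : p ≠ 0)]
  · rw [← Real.rpow_add_one (abs_pos.2 ha).ne']; congr 1; ring

lemma weakIntegrand_self (hp : 1 < p) (u : RN N → ℝ) (z : RN N × RN N) :
    weakIntegrand s p u u z = density s p u z := by
  unfold weakIntegrand density
  rw [abs_rpow_sub_two_mul_mul_self hp]

/-- A crude Young inequality: `|a|^(p-1) |b|` is at most the `p`-th power of the larger of `|a|` and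
`|b|`. -/
lemma abs_weakIntegrand_le (hp : 1 < p) (u v : RN N → ℝ) (z : RN N × RN N) :
    |weakIntegrand s p u v z| ≤ density s p u z + density s p v z := by
  unfold weakIntegrand density
  rw [abs_div, ← add_div, abs_of_nonneg (by positivity : 0 ≤ ‖z.1 - z.2‖ ^ ((N : ℝ) + s * p))]
  gcongr
  set a := u z.1 - u z.2
  set b := v z.1 - v z.2
  rw [abs_mul, abs_mul, abs_of_nonneg (by positivity : 0 ≤ |a| ^ (p - 2)),
    abs_rpow_sub_two_mul_abs hp]
  have key : ∀ x : ℝ, 0 ≤ x → x ^ (p - 1) * x = x ^ p := by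
    intro x hx
    rcases hx.eq_or_lt with rfl | hx
    · simp [Real.zero_rpow (by linarith : p ≠ 0)]
    · rw [← Real.rpow_add_one hx.ne']; congr 1; ring
  have ha : 0 ≤ |a| ^ p := by positivity
  have hb : 0 ≤ |b| ^ p := by positivity
  rcases le_total |a| |b| with h | h
  · have : |a| ^ (p - 1) * |b| ≤ |b| ^ (p - 1) * |b| :=
      mul_le_mul_of_nonneg_right (Real.rpow_le_rpow (abs_nonneg _) h (by linarith)) (abs_nonneg _)
    rw [key _ (abs_nonneg _)] at this
    linarith
  · have : |a| ^ (p - 1) * |b| ≤ |a| ^ (p - 1) * |a| :=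
      mul_le_mul_of_nonneg_left h (by positivity)
    rw [key _ (abs_nonneg _)] at this
    linarith

lemma aemeasurable_weakIntegrand (hu : AEMeasurable u) (hv : AEMeasurable v) :
    AEMeasurable (weakIntegrand s p u v) := by
  have h1 : AEMeasurable (fun z : RN N × RN N => |u z.1 - u z.2|) :=
    continuous_abs.measurable.comp_aemeasurable (aemeasurable_diff hu)
  exact ((((h1.pow_const (p - 2)).mul (aemeasurable_diff hu)).mul (aemeasurable_diff hv))).div
    measurable_kernel.aemeasurable

lemma integrable_density (hu : AEMeasurable u) (hE : energy s p u ≠ ⊤) :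
    Integrable (density s p u) :=
  (lintegral_ofReal_ne_top_iff_integrable (aemeasurable_density hu).aestronglyMeasurable
    (Eventually.of_forall (density_nonneg u))).1 hE

lemma integral_density (hu : AEMeasurable u) :
    ∫ z, density s p u z = (energy s p u).toReal := by
  rw [integral_eq_lintegral_of_nonneg_ae (Eventually.of_forall (density_nonneg u))
    (aemeasurable_density hu).aestronglyMeasurable, energy_eq_lintegral_density]

lemma integrable_weakIntegrand (hp : 1 < p) (hu : AEMeasurable u) (hv : AEMeasurable v)
    (huE : energy s p u ≠ ⊤) (hvE : energy s p v ≠ ⊤) : Integrable (weakIntegrand s p u v) :=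
  ((integrable_density hu huE).add (integrable_density hv hvE)).mono'
    (aemeasurable_weakIntegrand hu hv).aestronglyMeasurable
    (Eventually.of_forall (abs_weakIntegrand_le hp u v))

lemma lipschitzWith_mul_of_bounded {f g : ℝ → ℝ} {K K' A B : ℝ≥0} (hf : LipschitzWith K f)
    (hg : LipschitzWith K' g) (hA : ∀ x, |f x| ≤ A) (hB : ∀ x, |g x| ≤ B) :
    LipschitzWith (K * B + A * K') fun q : ℝ × ℝ => f q.1 * g q.2 := by
  refine LipschitzWith.of_dist_le_mul fun a b => ?_
  have h1 := hf.dist_le_mul a.1 b.1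
  have h2 := hg.dist_le_mul a.2 b.2
  rw [Real.dist_eq (f _)] at h1
  rw [Real.dist_eq (g _)] at h2
  have d1 : dist a.1 b.1 ≤ dist a b := le_max_left _ _
  have d2 : dist a.2 b.2 ≤ dist a b := le_max_right _ _
  rw [Real.dist_eq, show f a.1 * g a.2 - f b.1 * g b.2
    = (f a.1 - f b.1) * g a.2 + f b.1 * (g a.2 - g b.2) by ring]
  refine (abs_add_le _ _).trans ?_
  rw [abs_mul, abs_mul]
  push_cast
  rw [add_mul]
  refine add_le_add ?_ ?_
  · calc |f a.1 - f b.1| * |g a.2| ≤ (K * dist a b) * B :=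
          mul_le_mul (h1.trans (by gcongr)) (hB _) (abs_nonneg _) (by positivity)
      _ = _ := by ring
  · calc |f b.1| * |g a.2 - g b.2| ≤ A * (K' * dist a b) :=
          mul_le_mul (hA _) (h2.trans (by gcongr)) (abs_nonneg _) (by positivity)
      _ = _ := by ring

/-! ### Strong maximum principle -/

/-- Both factors must be bounded for their product to be Lipschitz; this is why the first variable
is truncated at `1`. -/
lemma exists_lipschitzWith_cutoff (n : ℕ) :
    ∃ K : ℝ≥0, LipschitzWith K fun q : ℝ × ℝ => min |q.1| 1 * max 0 (1 - n * |q.2|) := by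
  have h1 : LipschitzWith 1 (fun x : ℝ => min |x| 1) := by
    refine LipschitzWith.min_const ?_ 1
    exact LipschitzWith.of_dist_le_mul fun a b => by
      simpa [Real.dist_eq] using abs_abs_sub_abs_le_abs_sub a b
  have h2 : LipschitzWith (n : ℝ≥0) (fun x : ℝ => max 0 (1 - n * |x|)) := by
    refine LipschitzWith.const_max ?_ 0
    refine LipschitzWith.of_dist_le_mul fun a b => ?_
    rw [Real.dist_eq, Real.dist_eq, show 1 - n * |a| - (1 - n * |b|) = n * (|b| - |a|) by ring,
      abs_mul, Nat.abs_cast, abs_sub_comm a b]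
    have := abs_abs_sub_abs_le_abs_sub b a
    simp only [NNReal.coe_natCast]
    gcongr
  have hA : ∀ x : ℝ, |min |x| 1| ≤ (1 : ℝ≥0) := fun x => by
    rw [abs_of_nonneg (le_min (abs_nonneg x) zero_le_one), NNReal.coe_one]
    exact min_le_right _ _
  have hB : ∀ x : ℝ, |max 0 (1 - n * |x|)| ≤ (1 : ℝ≥0) := fun x => by
    have h0 : (0 : ℝ) ≤ n * |x| := by positivity
    rw [abs_of_nonneg (le_max_left _ _), NNReal.coe_one]
    exact max_le zero_le_one (by linarith)
  exact ⟨_, lipschitzWith_mul_of_bounded h1 h2 hA hB⟩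

lemma MemD.mul_cutoff (hN : 0 < N) (hs0 : 0 < s) (hs1 : s < 1) (hp : 1 < p)
    (hv : MemD s p v) (hu : MemD s p u) (n : ℕ) :
    MemD s p (fun x => min |v x| 1 * max 0 (1 - n * |u x|)) := by
  obtain ⟨K, hK⟩ := exists_lipschitzWith_cutoff n
  have h0 : min |((0 : ℝ), (0 : ℝ)).1| 1 * max 0 (1 - n * |((0 : ℝ), (0 : ℝ)).2|) = 0 := by simp
  exact MemD.comp₂ (Φ := fun q => min |q.1| 1 * max 0 (1 - n * |q.2|)) hN hs0 hs1 hp hv hu hK h0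

/-- The core of the maximum principle: the equation is tested with `φ · max 0 (1 - n u)`, which
concentrates on `{u = 0}` as `n` grows. -/
lemma ae_weak_product_eq_zero (hN : 0 < N) (hs0 : 0 < s) (hs1 : s < 1) (hp : 1 < p)
    (hu : IsEigenfunction s p w lam u) (hnn : ∀ᵐ x, 0 ≤ u x) {φ : RN N → ℝ}
    (hφ : MemD s p φ) (hφ0 : ∀ x, 0 ≤ φ x) (hφ1 : ∀ x, φ x ≤ 1) :
    ∀ᵐ z : RN N × RN N, u z.1 = 0 → 0 < u z.2 → φ z.1 = 0 := by
  obtain ⟨huD, -, hweak⟩ := hu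
  have hum := huD.aemeasurable
  have hφm := hφ.aemeasurable
  have huE := huD.energy_ne_top hN hs0 hs1 hp
  have hφE := hφ.energy_ne_top hN hs0 hs1 hp
  set V : ℕ → RN N → ℝ := fun n x => min |φ x| 1 * max 0 (1 - n * |u x|) with hV
  have hVD : ∀ n, MemD s p (V n) := fun n => hφ.mul_cutoff hN hs0 hs1 hp huD n
  have hV' : ∀ n x, V n x = φ x * max 0 (1 - n * |u x|) := fun n x => by
    simp only [hV]; rw [abs_of_nonneg (hφ0 x), min_eq_left (hφ1 x)]
  have hθ1 : ∀ (n : ℕ) (t : ℝ), max 0 (1 - n * |t|) ≤ 1 := fun n t => by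
    have : (0 : ℝ) ≤ n * |t| := by positivity
    exact max_le zero_le_one (by linarith)
  -- This limit is not known to be an admissible test function, so the equation is never tested with
  -- it; only its pointwise integrand is used, through Fatou.
  set V' : RN N → ℝ := fun x => if u x = 0 then φ x else 0 with hV'def
  have hVlim : ∀ x, Tendsto (fun n => V n x) atTop (𝓝 (V' x)) := by
    intro x
    by_cases h : u x = 0
    · have : ∀ n, V n x = V' x := fun n => by rw [hV']; simp [hV'def, h]
      simp only [this]; exact tendsto_const_nhds
    · have h1 : V' x = 0 := by simp [hV'def, h]
      rw [h1]
      refine tendsto_const_nhds.congr' ?_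
      obtain ⟨m, hm⟩ := exists_nat_gt (1 / |u x|)
      filter_upwards [eventually_ge_atTop m] with n hn
      have hux := abs_pos.2 h
      have h2 : 1 ≤ (n : ℝ) * |u x| := by
        rw [div_lt_iff₀ hux] at hm
        have : (m : ℝ) ≤ n := by exact_mod_cast hn
        nlinarith
      rw [hV', max_eq_left (by linarith), mul_zero]
  have hrhs : Tendsto (fun n => ∫ z, weakIntegrand s p u (V n) z) atTop (𝓝 0) := by
    have h1 : Tendsto (fun n => ∫ x, w x * |u x| ^ (p - 2) * u x * V n x) atTop
        (𝓝 (∫ _ : RN N, (0 : ℝ))) := by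
      refine tendsto_integral_of_dominated_convergence
        (fun x => |w x * |u x| ^ (p - 2) * u x * φ x|)
        (fun n => (hweak _ (hVD n)).1.aestronglyMeasurable) (hweak φ hφ).1.abs ?_ ?_
      · refine fun n => Eventually.of_forall fun x => ?_
        rw [Real.norm_eq_abs, hV', ← mul_assoc, abs_mul _ (max _ _)]
        refine mul_le_of_le_one_right (abs_nonneg _) ?_
        rw [abs_of_nonneg (le_max_left _ _)]
        exact hθ1 n _
      · refine Eventually.of_forall fun x => ?_
        have h2 := (hVlim x).const_mul (w x * |u x| ^ (p - 2) * u x)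
        have h3 : w x * |u x| ^ (p - 2) * u x * V' x = 0 := by
          by_cases h : u x = 0 <;> simp [hV'def, h]
        rwa [h3] at h2
    have h2 := h1.const_mul lam
    simp only [integral_zero, mul_zero] at h2
    exact h2.congr fun n => (hweak _ (hVD n)).2.symm
  set H : RN N × RN N → ℝ := fun z => |weakIntegrand s p u φ z| with hH
  have hHi : Integrable H := (integrable_weakIntegrand hp hum hφm huE hφE).abs
  have hWi : ∀ n, Integrable (weakIntegrand s p u (V n)) := fun n =>
    integrable_weakIntegrand hp hum (hVD n).aemeasurable huE
      ((hVD n).energy_ne_top hN hs0 hs1 hp)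
  -- An upper bound uniform in `n`: in the product rule for `φ · θ`, the term with the increment of
  -- `θ` is nonpositive because the cutoff decreases in `u`.
  have hWle : ∀ n, ∀ᵐ z, weakIntegrand s p u (V n) z ≤ H z := by
    intro n
    filter_upwards [ae_prod_of_ae hnn] with z hz
    simp only [hH]
    unfold weakIntegrand
    rw [abs_div, abs_of_nonneg (by positivity : 0 ≤ ‖z.1 - z.2‖ ^ ((N : ℝ) + s * p))]
    gcongr
    rw [hV', hV', abs_of_nonneg hz.1, abs_of_nonneg hz.2]
    set θx := max 0 (1 - n * u z.1) with hx
    set θy := max 0 (1 - n * u z.2) with hy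
    have hy0 : 0 ≤ θy := le_max_left _ _
    have hy1 : θy ≤ 1 := by
      have := hθ1 n (u z.2); rwa [abs_of_nonneg hz.2] at this
    have hmono : (u z.1 - u z.2) * (θx - θy) ≤ 0 := by
      have hn0 : (0 : ℝ) ≤ n := n.cast_nonneg
      rcases le_total (u z.1) (u z.2) with h | h
      · refine mul_nonpos_of_nonpos_of_nonneg (by linarith) (sub_nonneg.2 ?_)
        exact max_le_max le_rfl (by nlinarith)
      · refine mul_nonpos_of_nonneg_of_nonpos (by linarith) (sub_nonpos.2 ?_)
        exact max_le_max le_rfl (by nlinarith)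
    have hA : 0 ≤ |u z.1 - u z.2| ^ (p - 2) := by positivity
    set A := |u z.1 - u z.2| ^ (p - 2)
    calc A * (u z.1 - u z.2) * (φ z.1 * θx - φ z.2 * θy)
        = A * φ z.1 * ((u z.1 - u z.2) * (θx - θy))
          + A * (u z.1 - u z.2) * (φ z.1 - φ z.2) * θy := by ring
      _ ≤ 0 + |A * (u z.1 - u z.2) * (φ z.1 - φ z.2)| := by
          refine add_le_add (mul_nonpos_of_nonneg_of_nonpos (mul_nonneg hA (hφ0 _)) hmono) ?_
          refine (le_abs_self _).trans ?_
          rw [abs_mul _ θy, abs_of_nonneg hy0]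
          exact mul_le_of_le_one_right (abs_nonneg _) hy1
      _ = _ := zero_add _
  set G := weakIntegrand s p u V' with hG
  have hWlim : ∀ z, Tendsto (fun n => weakIntegrand s p u (V n) z) atTop (𝓝 (G z)) := fun z =>
    (((hVlim z.1).sub (hVlim z.2)).const_mul _).div_const _
  have hGm : AEMeasurable G := aemeasurable_of_tendsto_metrizable_ae'
    (fun n => (hWi n).aemeasurable) (Eventually.of_forall hWlim)
  -- If `u` vanishes at exactly one of the two points, the increments of `u` and `V'` have opposite
  -- signs; otherwise one of them is zero.
  have hG0 : ∀ᵐ z, G z ≤ 0 := by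
    filter_upwards [ae_prod_of_ae hnn] with z hz
    simp only [hG, weakIntegrand]
    rw [mul_assoc]
    refine div_nonpos_of_nonpos_of_nonneg (mul_nonpos_of_nonneg_of_nonpos (by positivity) ?_)
      (by positivity)
    have h1 := hφ0 z.1
    have h2 := hφ0 z.2
    by_cases hx : u z.1 = 0 <;> by_cases hy : u z.2 = 0 <;> simp only [hV'def, hx, hy, if_true,
      if_false] <;> nlinarith [hz.1, hz.2]
  -- Fatou for the nonnegative functions `H - weakIntegrand s p u (V n)`, whose integrals tend to `∫
  -- H`. With `G ≤ 0` this forces `G = 0` a.e.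
  have hfatou : ∫⁻ z, ENNReal.ofReal (H z - G z) ≤ ENNReal.ofReal (∫ z, H z) := by
    have hlim : Tendsto (fun n => ENNReal.ofReal (∫ z, (H z - weakIntegrand s p u (V n) z))) atTop
        (𝓝 (ENNReal.ofReal (∫ z, H z))) := by
      refine ENNReal.tendsto_ofReal ?_
      have : Tendsto (fun n => (∫ z, H z) - ∫ z, weakIntegrand s p u (V n) z) atTop
          (𝓝 (∫ z, H z)) := by
        simpa using hrhs.const_sub (∫ z, H z)
      refine this.congr fun n => ?_
      rw [integral_sub hHi (hWi n)]
    calc ∫⁻ z, ENNReal.ofReal (H z - G z)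
        = ∫⁻ z, liminf (fun n => ENNReal.ofReal (H z - weakIntegrand s p u (V n) z)) atTop := by
          refine lintegral_congr fun z => ?_
          exact (ENNReal.tendsto_ofReal ((hWlim z).const_sub (H z))).liminf_eq.symm
      _ ≤ liminf (fun n => ∫⁻ z, ENNReal.ofReal (H z - weakIntegrand s p u (V n) z)) atTop :=
          lintegral_liminf_le' fun n => (hHi.sub (hWi n)).aemeasurable.ennreal_ofReal
      _ = liminf (fun n => ENNReal.ofReal (∫ z, (H z - weakIntegrand s p u (V n) z))) atTop := by
          congr 1; ext n
          refine (ofReal_integral_eq_lintegral_ofReal (hHi.sub (hWi n)) ?_).symm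
          filter_upwards [hWle n] with z hz using sub_nonneg.2 hz
      _ = _ := hlim.liminf_eq
  have hGz : ∫⁻ z, ENNReal.ofReal (-G z) = 0 := by
    have h1 : ∫⁻ z, ENNReal.ofReal (H z - G z)
        = (∫⁻ z, ENNReal.ofReal (H z)) + ∫⁻ z, ENNReal.ofReal (-G z) := by
      rw [← lintegral_add_left' hHi.aemeasurable.ennreal_ofReal]
      refine lintegral_congr_ae ?_
      filter_upwards [hG0] with z hz
      rw [← ENNReal.ofReal_add (abs_nonneg _) (by linarith), sub_eq_add_neg]
    rw [h1, ofReal_integral_eq_lintegral_ofReal hHi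
      (Eventually.of_forall fun z => abs_nonneg _)] at hfatou
    have hfin : ∫⁻ z, ENNReal.ofReal (H z) ≠ ⊤ := hHi.lintegral_lt_top.ne
    simpa using ENNReal.le_of_add_le_add_left hfin (hfatou.trans_eq (add_zero _).symm)
  have hGae := (lintegral_eq_zero_iff' hGm.neg.ennreal_ofReal).1 hGz
  filter_upwards [hGae, hG0] with z h1 h2 hx hy
  have hGz0 : G z = 0 := by
    have : -G z ≤ 0 := by simpa using h1
    linarith
  have hne : z.1 ≠ z.2 := fun h => by rw [← h, hx] at hy; exact lt_irrefl _ hy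
  have hpos : 0 < ‖z.1 - z.2‖ ^ ((N : ℝ) + s * p) :=
    Real.rpow_pos_of_pos (norm_pos_iff.2 (sub_ne_zero.2 hne)) _
  have hpos2 : 0 < |0 - u z.2| ^ (p - 2) := Real.rpow_pos_of_pos (by simpa using hy.ne') _
  simp only [hG, weakIntegrand, hV'def, hx, hy.ne', if_true, if_false, sub_zero] at hGz0
  rw [div_eq_zero_iff] at hGz0
  rcases hGz0 with h | h
  · rcases mul_eq_zero.1 h with h | h
    · rcases mul_eq_zero.1 h with h | h
      · exact absurd h hpos2.ne'
      · linarith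
    · exact h
  · exact absurd h hpos.ne'

/-- Bumps equal to `1` on larger and larger balls show that almost no pair has `u x = 0 < u y`. If
`{u = 0}` were not null, Fubini would supply one such `x` for which `u y ≤ 0` for almost every `y`,
and `u` would vanish a.e. -/
theorem IsEigenfunction.ae_pos (hN : 0 < N) (hs0 : 0 < s) (hs1 : s < 1) (hp : 1 < p)
    (hu : IsEigenfunction s p w lam u) (hnn : ∀ᵐ x, 0 ≤ u x) : ∀ᵐ x, 0 < u x := by
  have hbump : ∀ j : ℕ, ∀ᵐ z : RN N × RN N, u z.1 = 0 → 0 < u z.2 → ¬ ‖z.1‖ ≤ j + 1 := by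
    intro j
    let φ : ContDiffBump (0 : RN N) := ⟨j + 1, j + 2, by positivity, by linarith⟩
    have hφ : MemD s p φ := memD_of_contDiff (by linarith) φ.contDiff φ.hasCompactSupport
    filter_upwards [ae_weak_product_eq_zero hN hs0 hs1 hp hu hnn hφ (fun x => φ.nonneg)
      (fun x => φ.le_one)] with z hz hx hy hle
    have h1 := φ.one_of_mem_closedBall (x := z.1) (mem_closedBall_zero_iff.2 hle)
    rw [hz hx hy] at h1
    exact zero_ne_one h1
  have hall : ∀ᵐ z : RN N × RN N, u z.1 = 0 → ¬ 0 < u z.2 := by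
    filter_upwards [ae_all_iff.2 hbump] with z hz hx hy
    obtain ⟨j, hj⟩ := exists_nat_ge ‖z.1‖
    exact hz j hx hy (by linarith)
  have hae : ∀ᵐ x : RN N, ∀ᵐ y : RN N, u x = 0 → ¬ 0 < u y := Measure.ae_ae_of_ae_prod hall
  by_contra hcon
  refine hu.2.1 ?_
  have hfreq : ∃ᵐ x, u x = 0 := by
    intro h
    refine hcon ?_
    filter_upwards [h, hnn] with x h1 h2 using lt_of_le_of_ne h2 (Ne.symm h1)
  obtain ⟨x, hx0, hx⟩ := (hfreq.and_eventually hae).exists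
  filter_upwards [hx, hnn] with y h1 h2
  exact le_antisymm (not_lt.1 (h1 hx0)) h2

/-! ### Picone's inequality and its consequence -/

/-- Joint convexity and homogeneity of `(c, a) ↦ c ^ p / a ^ (p - 1)`. -/
lemma add_rpow_div_rpow_le {p : ℝ} (hp : 1 ≤ p) {a b c d : ℝ} (ha : 0 < a) (hb : 0 < b)
    (hc : 0 ≤ c) (hd : 0 ≤ d) :
    (c + d) ^ p / (a + b) ^ (p - 1) ≤ c ^ p / a ^ (p - 1) + d ^ p / b ^ (p - 1) := by
  have hab : 0 < a + b := by positivity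
  have key : ∀ x y : ℝ, 0 ≤ x → 0 < y → x ^ p / y ^ (p - 1) = y * (x / y) ^ p := by
    intro x y hx hy
    have h1 := Real.rpow_pos_of_pos hy p
    rw [Real.div_rpow hx hy.le, Real.rpow_sub_one hy.ne']
    field_simp
  rw [key _ _ (by positivity) hab, key _ _ hc ha, key _ _ hd hb]
  have hx : c / a ∈ Set.Ici (0 : ℝ) := Set.mem_Ici.2 (by positivity)
  have hy : d / b ∈ Set.Ici (0 : ℝ) := Set.mem_Ici.2 (by positivity)
  have h := (convexOn_rpow hp).2 hx hy (by positivity : 0 ≤ a / (a + b))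
    (by positivity : 0 ≤ b / (a + b)) (by field_simp)
  simp only [smul_eq_mul] at h
  rw [show a / (a + b) * (c / a) + b / (a + b) * (d / b) = (c + d) / (a + b) by
    field_simp] at h
  calc (a + b) * ((c + d) / (a + b)) ^ p
      ≤ (a + b) * (a / (a + b) * (c / a) ^ p + b / (a + b) * (d / b) ^ p) := by gcongr
    _ = _ := by field_simp

/-- The discrete Picone inequality. -/
lemma picone {p : ℝ} (hp : 1 < p) {a b c d : ℝ} (ha : 0 < a) (hb : 0 < b)
    (hc : 0 ≤ c) (hd : 0 ≤ d) :
    |a - b| ^ (p - 2) * (a - b) * (c ^ p / a ^ (p - 1) - d ^ p / b ^ (p - 1)) ≤ |c - d| ^ p := by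
  have main : ∀ {a b c d : ℝ}, 0 < b → 0 ≤ c → 0 ≤ d → b < a →
      |a - b| ^ (p - 2) * (a - b) * (c ^ p / a ^ (p - 1) - d ^ p / b ^ (p - 1)) ≤ |c - d| ^ p := by
    intro a b c d hb hc hd hab
    have ha : 0 < a := hb.trans hab
    have hpos : 0 < a - b := sub_pos.2 hab
    have hA : |a - b| ^ (p - 2) * (a - b) = (a - b) ^ (p - 1) := by
      have := abs_rpow_sub_two_mul_abs hp (a - b)
      rwa [abs_of_pos hpos] at *
    rw [hA]
    have hA0 : 0 < (a - b) ^ (p - 1) := Real.rpow_pos_of_pos hpos _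
    rcases le_total c d with h | h
    · have h1 : c ^ p / a ^ (p - 1) ≤ d ^ p / b ^ (p - 1) := by
        have h2 : c ^ p ≤ d ^ p := Real.rpow_le_rpow hc h (by linarith)
        have h3 : b ^ (p - 1) ≤ a ^ (p - 1) := Real.rpow_le_rpow hb.le hab.le (by linarith)
        have h4 := Real.rpow_pos_of_pos hb (p - 1)
        gcongr
      have h5 : 0 ≤ |c - d| ^ p := by positivity
      exact (mul_nonpos_of_nonneg_of_nonpos hA0.le (sub_nonpos.2 h1)).trans h5
    -- Subadditivity is applied to the splittings `c = d + (c - d)` and `a = b + (a - b)`.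
    · have h1 := add_rpow_div_rpow_le hp.le hb hpos hd (sub_nonneg.2 h)
      rw [add_sub_cancel, add_sub_cancel] at h1
      rw [abs_of_nonneg (sub_nonneg.2 h), mul_comm, ← le_div_iff₀ hA0]
      linarith
  rcases lt_trichotomy a b with h | rfl | h
  · have := main ha hd hc h
    rw [abs_sub_comm b a, abs_sub_comm d c] at this
    linarith
  · rw [sub_self, mul_zero, zero_mul]; positivity
  · exact main hb hc hd h

lemma exists_lipschitzWith_min_rpow {p : ℝ} (hp : 1 ≤ p) {k : ℝ} (hk : 0 ≤ k) :
    ∃ K : ℝ≥0, LipschitzWith K fun x : ℝ => (min |x| k) ^ p := by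
  refine ⟨⟨p * k ^ (p - 1), by positivity⟩, LipschitzWith.of_dist_le_mul fun x y => ?_⟩
  have hmem : ∀ x : ℝ, min |x| k ∈ Set.Icc 0 k := fun x =>
    ⟨le_min (abs_nonneg _) hk, min_le_right _ _⟩
  have h1 := Convex.norm_image_sub_le_of_norm_hasDerivWithin_le (f := fun t : ℝ => t ^ p)
    (f' := fun t => p * t ^ (p - 1)) (C := p * k ^ (p - 1)) (s := Set.Icc 0 k)
    (fun t _ => (Real.hasDerivAt_rpow_const (Or.inr hp)).hasDerivWithinAt)
    (fun t ht => by
      have h0 : 0 ≤ t := ht.1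
      rw [Real.norm_of_nonneg (by positivity)]
      have := Real.rpow_le_rpow h0 ht.2 (by linarith : 0 ≤ p - 1)
      gcongr)
    (convex_Icc 0 k) (hmem y) (hmem x)
  have h2 : |min |x| k - min |y| k| ≤ |x - y| :=
    (abs_min_sub_min_le_max _ _ _ _).trans (by
      rw [sub_self, abs_zero]
      exact max_le (abs_abs_sub_abs_le_abs_sub x y) (abs_nonneg _))
  rw [Real.dist_eq, Real.dist_eq]
  simp only [Real.norm_eq_abs] at h1
  refine h1.trans ?_
  exact mul_le_mul_of_nonneg_left h2 (by positivity)

lemma exists_lipschitzWith_inv_rpow {q ε : ℝ} (hq : 0 ≤ q) (hε : 0 < ε) :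
    ∃ K : ℝ≥0, LipschitzWith K fun x : ℝ => (|x| + ε) ^ (-q) := by
  refine ⟨⟨q * ε ^ (-q - 1), by positivity⟩, LipschitzWith.of_dist_le_mul fun x y => ?_⟩
  have hmem : ∀ x : ℝ, |x| + ε ∈ Set.Ici ε := fun x => by simp
  have h1 := Convex.norm_image_sub_le_of_norm_hasDerivWithin_le (f := fun t : ℝ => t ^ (-q))
    (f' := fun t => -q * t ^ (-q - 1)) (C := q * ε ^ (-q - 1)) (s := Set.Ici ε)
    (fun t ht => (Real.hasDerivAt_rpow_const
      (Or.inl (hε.trans_le (Set.mem_Ici.1 ht)).ne')).hasDerivWithinAt)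
    (fun t ht => by
      have h0 : 0 < t := hε.trans_le (Set.mem_Ici.1 ht)
      rw [norm_mul, norm_neg, Real.norm_of_nonneg hq, Real.norm_of_nonneg (by positivity)]
      have := Real.rpow_le_rpow_of_nonpos hε (Set.mem_Ici.1 ht) (by linarith : -q - 1 ≤ 0)
      gcongr)
    (convex_Ici ε) (hmem y) (hmem x)
  rw [Real.dist_eq, Real.dist_eq]
  simp only [Real.norm_eq_abs, add_sub_add_right_eq_sub] at h1
  refine h1.trans ?_
  exact mul_le_mul_of_nonneg_left (abs_abs_sub_abs_le_abs_sub x y) (by positivity)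

/-- The formal test function `|v|^p / u^(p-1)` is not a Lipschitz function of `(v, u)`; truncating
`|v|` at `k` and shifting `|u|` by `ε` makes it one, with value `0` at the origin. -/
lemma MemD.picone_test (hN : 0 < N) (hs0 : 0 < s) (hs1 : s < 1) (hp : 1 < p)
    (hv : MemD s p v) (hu : MemD s p u) {k ε : ℝ} (hk : 0 ≤ k) (hε : 0 < ε) :
    MemD s p (fun x => (min |v x| k) ^ p * (|u x| + ε) ^ (-(p - 1))) := by
  obtain ⟨K, hK⟩ := exists_lipschitzWith_min_rpow hp.le hk
  obtain ⟨K', hK'⟩ := exists_lipschitzWith_inv_rpow (q := p - 1) (by linarith) hε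
  have hA : ∀ x : ℝ, |(min |x| k) ^ p| ≤ (⟨k ^ p, by positivity⟩ : ℝ≥0) := fun x => by
    have h0 : 0 ≤ min |x| k := le_min (abs_nonneg _) hk
    rw [abs_of_nonneg (by positivity)]
    exact Real.rpow_le_rpow h0 (min_le_right _ _) (by linarith)
  have hB : ∀ x : ℝ, |(|x| + ε) ^ (-(p - 1))| ≤ (⟨ε ^ (-(p - 1)), by positivity⟩ : ℝ≥0) :=
    fun x => by
      rw [abs_of_nonneg (by positivity)]
      exact Real.rpow_le_rpow_of_nonpos hε (by simp) (by linarith)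
  have h0 : (min |((0 : ℝ), (0 : ℝ)).1| k) ^ p * (|((0 : ℝ), (0 : ℝ)).2| + ε) ^ (-(p - 1)) = 0 := by
    simp [min_eq_left hk, Real.zero_rpow (by linarith : p ≠ 0)]
  exact MemD.comp₂ (Φ := fun q => (min |q.1| k) ^ p * (|q.2| + ε) ^ (-(p - 1)))
    hN hs0 hs1 hp hv hu (lipschitzWith_mul_of_bounded hK hK' hA hB) h0

/-- Picone survives the regularization: the shift by `ε` leaves the differences of `u` unchanged,
and `min |·| k` is 1-Lipschitz. -/
lemma weakIntegrand_picone_le (hp : 1 < p) {k ε : ℝ} (hk : 0 ≤ k) (hε : 0 < ε)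
    {z : RN N × RN N} (h1 : 0 < u z.1) (h2 : 0 < u z.2) :
    weakIntegrand s p u (fun x => (min |v x| k) ^ p * (|u x| + ε) ^ (-(p - 1))) z ≤
      density s p v z := by
  unfold weakIntegrand density
  gcongr
  have hm : ∀ x : ℝ, 0 ≤ min |x| k := fun x => le_min (abs_nonneg _) hk
  have h := picone hp (a := u z.1 + ε) (b := u z.2 + ε) (by positivity) (by positivity)
    (hm (v z.1)) (hm (v z.2))
  rw [add_sub_add_right_eq_sub, div_eq_mul_inv, div_eq_mul_inv, ← Real.rpow_neg (by positivity),
    ← Real.rpow_neg (by positivity)] at h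
  dsimp only
  rw [abs_of_pos h1, abs_of_pos h2]
  refine h.trans (Real.rpow_le_rpow (abs_nonneg _) ?_ (by linarith))
  refine (abs_min_sub_min_le_max _ _ _ _).trans ?_
  rw [sub_self, abs_zero]
  exact max_le (abs_abs_sub_abs_le_abs_sub _ _) (abs_nonneg _)

theorem IsEigenfunction.mul_integral_le_energy (hN : 0 < N) (hs0 : 0 < s) (hs1 : s < 1)
    (hp : 1 < p) (hu : IsEigenfunction s p w lam u) (hpos : ∀ᵐ x, 0 < u x) (hv : MemD s p v)
    (hint : Integrable fun x => w x * |v x| ^ p) :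
    lam * ∫ x, w x * |v x| ^ p ≤ (energy s p v).toReal := by
  obtain ⟨huD, -, hweak⟩ := hu
  have hum := huD.aemeasurable
  have huE := huD.energy_ne_top hN hs0 hs1 hp
  have hvE := hv.energy_ne_top hN hs0 hs1 hp
  set V : ℕ → RN N → ℝ := fun n x =>
    (min |v x| n) ^ p * (|u x| + 1 / ((n : ℝ) + 1)) ^ (-(p - 1)) with hV
  have hε : ∀ n : ℕ, (0 : ℝ) < 1 / ((n : ℝ) + 1) := fun n => by positivity
  have hVD : ∀ n, MemD s p (V n) := fun n =>
    hv.picone_test hN hs0 hs1 hp huD n.cast_nonneg (hε n)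
  have hle : ∀ n, lam * ∫ x, w x * |u x| ^ (p - 2) * u x * V n x ≤ (energy s p v).toReal := by
    intro n
    rw [← (hweak _ (hVD n)).2, weakForm_eq_integral, ← integral_density hv.aemeasurable]
    refine integral_mono_ae (integrable_weakIntegrand hp hum (hVD n).aemeasurable huE
      ((hVD n).energy_ne_top hN hs0 hs1 hp)) (integrable_density hv.aemeasurable hvE) ?_
    filter_upwards [ae_prod_of_ae hpos] with z hz
    exact weakIntegrand_picone_le hp n.cast_nonneg (hε n) hz.1 hz.2
  -- In this form the last factor lies in `[0, 1]` and tends to `1`, so `|w| |v|^p` dominates even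
  -- though `w` may change sign.
  have hprod : ∀ n x, 0 < u x → w x * |u x| ^ (p - 2) * u x * V n x =
      w x * (min |v x| n) ^ p * (u x / (u x + 1 / ((n : ℝ) + 1))) ^ (p - 1) := by
    intro n x hx
    have h1 := abs_rpow_sub_two_mul_abs hp (u x)
    have h2 := hε n
    rw [abs_of_pos hx] at h1
    simp only [hV]
    rw [abs_of_pos hx, mul_assoc (w x), h1, Real.rpow_neg (by positivity),
      Real.div_rpow hx.le (by positivity)]
    ring
  have hlim : Tendsto (fun n => ∫ x, w x * |u x| ^ (p - 2) * u x * V n x) atTop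
      (𝓝 (∫ x, w x * |v x| ^ p)) := by
    refine tendsto_integral_of_dominated_convergence (fun x => |w x * |v x| ^ p|)
      (fun n => (hweak _ (hVD n)).1.aestronglyMeasurable) hint.abs ?_ ?_
    · intro n
      filter_upwards [hpos] with x hx
      have h2 := hε n
      have hm : 0 ≤ min |v x| n := le_min (abs_nonneg _) n.cast_nonneg
      rw [hprod n x hx, Real.norm_eq_abs, abs_mul, abs_mul, abs_mul,
        abs_of_nonneg (by positivity : 0 ≤ (min |v x| n) ^ p),
        abs_of_nonneg (by positivity : 0 ≤ |v x| ^ p),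
        abs_of_nonneg (by positivity : 0 ≤ (u x / (u x + 1 / ((n : ℝ) + 1))) ^ (p - 1))]
      have h3 : (min |v x| n) ^ p ≤ |v x| ^ p :=
        Real.rpow_le_rpow hm (min_le_left _ _) (by linarith)
      have h4 : (u x / (u x + 1 / ((n : ℝ) + 1))) ^ (p - 1) ≤ 1 := by
        refine Real.rpow_le_one (by positivity) ?_ (by linarith)
        rw [div_le_one (by positivity)]
        linarith
      refine (mul_le_of_le_one_right (by positivity) h4).trans ?_
      gcongr
    · filter_upwards [hpos] with x hx
      have h1 : Tendsto (fun n : ℕ => (u x / (u x + 1 / ((n : ℝ) + 1))) ^ (p - 1)) atTop (𝓝 1) := by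
        have h2 : Tendsto (fun n : ℕ => u x / (u x + 1 / ((n : ℝ) + 1))) atTop (𝓝 1) := by
          have := (tendsto_one_div_add_atTop_nhds_zero_nat (𝕜 := ℝ)).const_add (u x)
          rw [add_zero] at this
          have := (tendsto_const_nhds (x := u x)).div this hx.ne'
          rwa [div_self hx.ne'] at this
        have := h2.rpow_const (p := p - 1) (Or.inl one_ne_zero)
        rwa [Real.one_rpow] at this
      have h3 : Tendsto (fun n : ℕ => w x * |v x| ^ p *
          (u x / (u x + 1 / ((n : ℝ) + 1))) ^ (p - 1)) atTop (𝓝 (w x * |v x| ^ p)) := by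
        simpa using h1.const_mul (w x * |v x| ^ p)
      refine h3.congr' ?_
      obtain ⟨m, hm⟩ := exists_nat_ge |v x|
      filter_upwards [eventually_ge_atTop m] with n hn
      have : |v x| ≤ n := hm.trans (by exact_mod_cast hn)
      rw [hprod n x hx, min_eq_left this]
  exact le_of_tendsto' (hlim.const_mul lam) hle

/-! ### Eigenfunctions of constant sign -/

lemma IsEigenfunction.neg (hu : IsEigenfunction s p w lam u) :
    IsEigenfunction s p w lam (fun x => -u x) := by
  obtain ⟨huD, hu0, hweak⟩ := hu
  refine ⟨huD.neg, by simpa using hu0, fun v hv => ?_⟩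
  obtain ⟨h1, h2⟩ := hweak v hv
  have e1 : (fun x => w x * |-u x| ^ (p - 2) * -u x * v x)
      = fun x => -(w x * |u x| ^ (p - 2) * u x * v x) := by
    ext x; rw [abs_neg]; ring
  have e2 : weakForm s p (fun x => -u x) v = -weakForm s p u v := by
    unfold weakForm
    rw [← integral_neg]
    congr 1; ext z
    rw [show -u z.1 - -u z.2 = -(u z.1 - u z.2) by ring, abs_neg]
    ring
  rw [e1, e2]
  refine ⟨h1.neg, ?_⟩
  rw [integral_neg, h2]
  ring

theorem IsEigenfunction.eq_firstEigenvalue_of_nonneg (hN : 0 < N) (hs0 : 0 < s) (hs1 : s < 1)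
    (hp : 1 < p) (hsp : s * p < N) (hlam : 0 ≤ lam) (hu : IsEigenfunction s p w lam u)
    (hnn : ∀ᵐ x, 0 ≤ u x) : lam = firstEigenvalue s p w := by
  have hp0 : 0 < p := by linarith
  have hpos := hu.ae_pos hN hs0 hs1 hp hnn
  have hle := fun {v : RN N → ℝ} => hu.mul_integral_le_energy hN hs0 hs1 hp hpos (v := v)
  obtain ⟨huD, hu0, hweak⟩ := hu
  have huE := huD.energy_ne_top hN hs0 hs1 hp
  obtain ⟨hi, he⟩ := hweak u huD
  have heq : (fun x => w x * |u x| ^ (p - 2) * u x * u x) = fun x => w x * |u x| ^ p := by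
    ext x
    rw [← abs_rpow_sub_two_mul_mul_self hp (u x)]; ring
  rw [heq] at hi he
  have hform : weakForm s p u u = (energy s p u).toReal := by
    rw [weakForm_eq_integral, ← integral_density huD.aemeasurable]
    exact integral_congr_ae (Eventually.of_forall (weakIntegrand_self hp u))
  rw [hform] at he
  set I : ℝ := ∫ x, w x * |u x| ^ p with hI
  have hE0 : 0 < (energy s p u).toReal := ENNReal.toReal_pos
    (fun h => hu0 (huD.ae_eq_zero_of_energy_eq_zero hN hs0 hs1 hp hsp h)) huE
  -- Positive energy together with `0 ≤ lam` makes `I` positive, so `u` can be normalized. In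
  -- particular the infimum is over a nonempty set and the convention for `sInf ∅` plays no role.
  have hI0 : 0 < I := by
    rw [he] at hE0
    exact pos_of_mul_pos_right hE0 hlam
  refine (IsLeast.csInf_eq ⟨?_, ?_⟩).symm
  -- Scaling by `c` multiplies both `∫ w|u|^p` and the energy by `I⁻¹`, giving the values `1` and
  -- `lam`.
  · set c : ℝ := I ^ (-(1 / p)) with hc
    have hc0 : 0 ≤ c := by positivity
    have hcp : c ^ p = I⁻¹ := by
      rw [hc, ← Real.rpow_mul hI0.le, ← Real.rpow_neg_one]; congr 1; field_simp
    have hfun : (fun x => w x * |c * u x| ^ p) = fun x => I⁻¹ * (w x * |u x| ^ p) := by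
      ext x
      rw [abs_mul, abs_of_nonneg hc0, Real.mul_rpow hc0 (abs_nonneg _), hcp]; ring
    refine ⟨fun x => c * u x, huD.const_mul hN hs0 hs1 hp c, ?_, ?_, ?_⟩
    · rw [hfun]; exact hi.const_mul _
    · rw [hfun, integral_const_mul, ← hI, inv_mul_cancel₀ hI0.ne']
    · rw [energy_const_mul hc0, hcp, ENNReal.toReal_mul,
        ENNReal.toReal_ofReal (inv_nonneg.2 hI0.le), he]
      field_simp
  · rintro t ⟨v, hv, hvi, hv1, rfl⟩
    have := hle hv hvi
    rwa [hv1, mul_one] at this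

end FracHardy

theorem mainTheorem8 (N : ℕ) (s p : ℝ) (hs0 : 0 < s) (hs1 : s < 1) (hp : 1 < p)
    (hsp : s * p < (N : ℝ))
    (w₁ w₂ : FracHardy.RN N → ℝ)
    (hw₁ : FracHardy.MemHardyZero s p w₁) (hw₁_nonneg : ∀ᵐ x, 0 ≤ w₁ x)
    (hw₂ : LocallyIntegrable w₂) (hw₂_nonneg : ∀ᵐ x, 0 ≤ w₂ x)
    (lam : ℝ) (hlam_nonneg : 0 ≤ lam)
    (hlam : lam ≠ FracHardy.firstEigenvalue s p (fun x => w₁ x - w₂ x))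
    (u : FracHardy.RN N → ℝ)
    (hu : FracHardy.IsEigenfunction s p (fun x => w₁ x - w₂ x) lam u) :
    FracHardy.ChangesSign u := by
  have hN : 0 < N := by
    have : (0 : ℝ) < N := lt_of_le_of_lt (by positivity) hsp
    exact_mod_cast this
  constructor
  · refine pos_iff_ne_zero.2 fun h => hlam ?_
    refine hu.neg.eq_firstEigenvalue_of_nonneg hN hs0 hs1 hp hsp hlam_nonneg ?_
    have h' : ∀ᵐ x, ¬ 0 < u x := measure_eq_zero_iff_ae_notMem.1 h
    filter_upwards [h'] with x hx
    exact neg_nonneg.2 (not_lt.1 hx)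
  · refine pos_iff_ne_zero.2 fun h => hlam ?_
    refine hu.eq_firstEigenvalue_of_nonneg hN hs0 hs1 hp hsp hlam_nonneg ?_
    have h' : ∀ᵐ x, ¬ u x < 0 := measure_eq_zero_iff_ae_notMem.1 h
    filter_upwards [h'] with x hx
    exact not_lt.1 hx
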